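/- Let $n>1$, $0\le q\le n$ and $\varphi(z)=|z_1|^2+\dots+|z_n|^2$ on $\mathbb{C}^n$. Let $L^2_{(0,q)}(\mathbb{C}^n,e^{-\varphi})$ be the Hilbert space of $(0,q)$-forms $u=\sum'_{|J|=q}u_J\,d\overline z_J$ (sum over increasing multiindices $J$) with $\|u\|_\varphi^2=\sum'_{|J|=q}\int_{\mathbb{C}^n}|u_J|^2e^{-\varphi}\,d\lambda<\infty$, where $\lambda$ is Lebesgue measure. For forms with coefficients in $\mathcal{C}_0^\infty(\mathbb{C}^n)$ put $$\overline\partial u=\sum_{|J|=q}{}^{\!\prime}\,\sum_{j=1}^n\frac{\partial u_J}{\partial\overline z_j}\,d\overline z_j\wedge d\overline z_J,\qquad \overline\partial^*_\varphi u=-\sum_{|K|=q-1}{}^{\!\!\prime}\,\sum_{k=1}^n\delta_k u_{kK}\,d\overline z_K,\qquad \delta_k=\frac{\partial}{\partial z_k}-\frac{\partial\varphi}{\partial z_k},$$ where $u_{kK}$ denotes the antisymmetrically extended coefficients ($\overline\partial^*_\varphi=0$ on $(0,0)$-forms, $\overline\partial=0$ on $(0,n)$-forms). Let the $\overline\partial$-Neumann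 Laplacian $\square_{\varphi,q}$ be the closure in $L^2_{(0,q)}(\mathbb{C}^n,e^{-\varphi})$ of the operator $\overline\partial\,\overline\partial^*_\varphi+\overline\partial^*_\varphi\,\overline\partial$ defined on the $(0,q)$-forms with coefficients in $\mathcal{C}_0^\infty(\mathbb{C}^n)$. Then $\square_{\varphi,q}$ is self-adjoint, its spectrum is exactly the set of integers $\{q,q+1,q+2,\dots\}$, and each of these integers is an eigenvalue of $\square_{\varphi,q}$ of infinite multiplicity, that is, with an infinite-dimensional eigenspace. -/

import Mathlib

open MeasureTheory
open scoped ContDiff Distributions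

noncomputable section

namespace FockDbar

/-! ### Wirtinger derivatives and the weight -/

/-- The Wirtinger derivative `∂f/∂z_k = (∂f/∂x_k - i ∂f/∂y_k) / 2`, where `z_k = x_k + i y_k`. -/
def dz {n : ℕ} (k : Fin n) (f : (Fin n → ℂ) → ℂ) (z : Fin n → ℂ) : ℂ :=
  (1 / 2 : ℂ) *
    (fderiv ℝ f z (Pi.single k 1) - Complex.I * fderiv ℝ f z (Pi.single k Complex.I))

/-- The Wirtinger derivative `∂f/∂z̄_k = (∂f/∂x_k + i ∂f/∂y_k) / 2`. -/
def dzbar {n : ℕ} (k : Fin n) (f : (Fin n → ℂ) → ℂ) (z : Fin n → ℂ) : ℂ :=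
  (1 / 2 : ℂ) *
    (fderiv ℝ f z (Pi.single k 1) + Complex.I * fderiv ℝ f z (Pi.single k Complex.I))

/-- The weight `φ(z) = |z_1|² + ⋯ + |z_n|²`. -/
def weight {n : ℕ} (z : Fin n → ℂ) : ℝ := ∑ j, ‖z j‖ ^ 2

/-- The operator `δ_k = ∂/∂z_k - ∂φ/∂z_k`. -/
def delta {n : ℕ} (k : Fin n) (f : (Fin n → ℂ) → ℂ) (z : Fin n → ℂ) : ℂ :=
  dz k f z - dz k (fun w => (weight w : ℂ)) z * f z

theorem contDiff_weight {n : ℕ} : ContDiff ℝ ∞ (weight : (Fin n → ℂ) → ℝ) := by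
  unfold weight
  exact ContDiff.sum fun j _ => (contDiff_apply ℝ ℂ j).norm_sq ℝ

theorem contDiff_dz {n : ℕ} (k : Fin n) {f : (Fin n → ℂ) → ℂ} (hf : ContDiff ℝ ∞ f) :
    ContDiff ℝ ∞ (dz k f) := by
  have h : ContDiff ℝ ∞ (fderiv ℝ f) := hf.fderiv_right (by simp)
  unfold dz
  fun_prop

theorem contDiff_dzbar {n : ℕ} (k : Fin n) {f : (Fin n → ℂ) → ℂ} (hf : ContDiff ℝ ∞ f) :
    ContDiff ℝ ∞ (dzbar k f) := by
  have h : ContDiff ℝ ∞ (fderiv ℝ f) := hf.fderiv_right (by simp)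
  unfold dzbar
  fun_prop

theorem contDiff_delta {n : ℕ} (k : Fin n) {f : (Fin n → ℂ) → ℂ} (hf : ContDiff ℝ ∞ f) :
    ContDiff ℝ ∞ (delta k f) := by
  have h1 := contDiff_dz k hf
  have h2 : ContDiff ℝ ∞ (dz k (fun w : Fin n → ℂ => (weight w : ℂ))) :=
    contDiff_dz k (Complex.ofRealCLM.contDiff.comp contDiff_weight)
  unfold delta
  exact h1.sub (h2.mul hf)

theorem hasCompactSupport_dz {n : ℕ} (k : Fin n) {f : (Fin n → ℂ) → ℂ}
    (hf : HasCompactSupport f) : HasCompactSupport (dz k f) := by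
  refine (hf.fderiv ℝ).mono fun z hz h0 => hz ?_
  simp [dz, h0]

theorem hasCompactSupport_dzbar {n : ℕ} (k : Fin n) {f : (Fin n → ℂ) → ℂ}
    (hf : HasCompactSupport f) : HasCompactSupport (dzbar k f) := by
  refine (hf.fderiv ℝ).mono fun z hz h0 => hz ?_
  simp [dzbar, h0]

theorem hasCompactSupport_delta {n : ℕ} (k : Fin n) {f : (Fin n → ℂ) → ℂ}
    (hf : HasCompactSupport f) : HasCompactSupport (delta k f) :=
  (hasCompactSupport_dz k hf).sub hf.mul_left

/-! ### Operators on test functions -/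

/-- The space `C_0^∞(ℂⁿ)` of smooth complex-valued functions with compact support. -/
abbrev TestFun (n : ℕ) : Type := 𝓓((⊤ : TopologicalSpace.Opens (Fin n → ℂ)), ℂ)

theorem TestFun.differentiableAt {n : ℕ} (f : TestFun n) (z : Fin n → ℂ) :
    DifferentiableAt ℝ f z :=
  (f.contDiff.differentiable (by simp)) z

/-- `∂/∂z̄_k` on test functions. -/
def dzbarTest {n : ℕ} (k : Fin n) : TestFun n →ₗ[ℂ] TestFun n where
  toFun f := ⟨dzbar k f, contDiff_dzbar k f.contDiff,
    hasCompactSupport_dzbar k f.hasCompactSupport, fun _ _ => trivial⟩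
  map_add' f g := by
    ext z
    change dzbar k (⇑f + ⇑g) z = dzbar k f z + dzbar k g z
    simp only [dzbar, fderiv_add (f.differentiableAt z) (g.differentiableAt z),
      add_apply]
    ring
  map_smul' c f := by
    ext z
    change dzbar k (c • ⇑f) z = c * dzbar k f z
    simp only [dzbar, fderiv_const_smul (f.differentiableAt z),
      smul_apply, smul_eq_mul]
    ring

/-- `δ_k` on test functions. -/
def deltaTest {n : ℕ} (k : Fin n) : TestFun n →ₗ[ℂ] TestFun n where
  toFun f := ⟨delta k f, contDiff_delta k f.contDiff,
    hasCompactSupport_delta k f.hasCompactSupport, fun _ _ => trivial⟩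
  map_add' f g := by
    ext z
    change delta k (⇑f + ⇑g) z = delta k f z + delta k g z
    simp only [delta, dz, fderiv_add (f.differentiableAt z) (g.differentiableAt z),
      add_apply, Pi.add_apply]
    ring
  map_smul' c f := by
    ext z
    change delta k (c • ⇑f) z = c * delta k f z
    simp only [delta, dz, fderiv_const_smul (f.differentiableAt z),
      smul_apply, smul_eq_mul, Pi.smul_apply]
    ring

/-! ### The weighted `∂̄`-complex on test forms -/

/-- Increasing multiindices `J = (j_1 < ⋯ < j_q)`, represented by their sets of entries. -/
abbrev MultiIndex (n q : ℕ) : Type := {J : Finset (Fin n) // J.card = q}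

/-- Smooth compactly supported `(0,q)`-forms `u = ∑'_{|J|=q} u_J dz̄_J`, given by their
coefficients. -/
abbrev TestForm (n q : ℕ) : Type := MultiIndex n q → TestFun n

/-- The coefficient of `dz̄_K` in `dz̄_j ∧ dz̄_J`, that is `(-1)^#{i ∈ J : i < j}` if `j ∉ J` and
`K = J ∪ {j}`, and `0` otherwise. -/
def wedgeCoeff {n : ℕ} (j : Fin n) (J K : Finset (Fin n)) : ℂ :=
  if j ∉ J ∧ insert j J = K then (-1) ^ (J.filter (· < j)).card else 0

/-- `∂̄ u = ∑'_{|J|=q} ∑_j (∂u_J/∂z̄_j) dz̄_j ∧ dz̄_J`. -/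
def dbar (n q : ℕ) : TestForm n q →ₗ[ℂ] TestForm n (q + 1) :=
  LinearMap.pi fun K => ∑ J : MultiIndex n q, ∑ j : Fin n,
    wedgeCoeff j J.1 K.1 • (dzbarTest j ∘ₗ LinearMap.proj J)

/-- `∂̄*_φ u = - ∑'_{|K|=q} ∑_k (δ_k u_{kK}) dz̄_K` on `(0,q+1)`-forms, where `u_{kK}` is the
antisymmetric extension of the coefficients: `u_{kK} = ∑'_{|J|=q+1} ε u_J`, with `ε` the
coefficient of `dz̄_J` in `dz̄_k ∧ dz̄_K`. -/
def dbarStar (n q : ℕ) : TestForm n (q + 1) →ₗ[ℂ] TestForm n q :=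
  LinearMap.pi fun K => -∑ k : Fin n,
    deltaTest k ∘ₗ (∑ J : MultiIndex n (q + 1), wedgeCoeff k K.1 J.1 • LinearMap.proj J)

/-- The complex Laplacian `∂̄ ∂̄*_φ + ∂̄*_φ ∂̄` on test `(0,q)`-forms; for `q = 0` the first summand
is absent, and for `q = n` the second one vanishes because there are no `(0,n+1)`-forms. -/
def boxTest (n : ℕ) : (q : ℕ) → TestForm n q →ₗ[ℂ] TestForm n q
  | 0 => dbarStar n 0 ∘ₗ dbar n 0
  | q + 1 => dbar n q ∘ₗ dbarStar n q + dbarStar n (q + 1) ∘ₗ dbar n (q + 1)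

/-! ### The weighted `L²` spaces -/

/-- The measure `e^{-φ} dλ` on `ℂⁿ`, with `λ` the Lebesgue measure. -/
def weightMeasure (n : ℕ) : Measure (Fin n → ℂ) :=
  volume.withDensity fun z => ENNReal.ofReal (Real.exp (-weight z))

/-- `L²_{(0,q)}(ℂⁿ, e^{-φ})`: the Hilbert space of `(0,q)`-forms with coefficients in
`L²(ℂⁿ, e^{-φ})`, with squared norm `∑'_J ‖u_J‖²_φ`. -/
abbrev L2Form (n q : ℕ) : Type :=
  PiLp 2 fun _ : MultiIndex n q => Lp ℂ 2 (weightMeasure n)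

theorem continuous_exp_neg_weight {n : ℕ} :
    Continuous fun z : Fin n → ℂ => Real.exp (-weight z) :=
  Real.continuous_exp.comp contDiff_weight.continuous.neg

instance instIsLocallyFiniteMeasureWeightMeasure (n : ℕ) :
    IsLocallyFiniteMeasure (weightMeasure n) :=
  IsLocallyFiniteMeasure.withDensity_ofReal continuous_exp_neg_weight

instance instIsOpenPosMeasureWeightMeasure (n : ℕ) :
    (weightMeasure n).IsOpenPosMeasure := by
  refine Measure.AbsolutelyContinuous.isOpenPosMeasure (μ := volume) ?_
  refine withDensity_absolutelyContinuous' ?_ ?_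
  · exact continuous_exp_neg_weight.measurable.ennreal_ofReal.aemeasurable
  · filter_upwards with z
    simp [Real.exp_pos]

theorem TestFun.memLp {n : ℕ} (f : TestFun n) : MemLp f 2 (weightMeasure n) :=
  f.contDiff.continuous.memLp_of_hasCompactSupport f.hasCompactSupport

/-- The inclusion of `C_0^∞(ℂⁿ)` in `L²(ℂⁿ, e^{-φ})`. -/
def testToL2 (n : ℕ) : TestFun n →ₗ[ℂ] Lp ℂ 2 (weightMeasure n) where
  toFun f := f.memLp.toLp f
  map_add' f g := MemLp.toLp_add f.memLp g.memLp
  map_smul' c f := MemLp.toLp_const_smul c f.memLp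

/-- The inclusion of the test `(0,q)`-forms in `L²_{(0,q)}(ℂⁿ, e^{-φ})`. -/
def formToL2 (n q : ℕ) : TestForm n q →ₗ[ℂ] L2Form n q :=
  (WithLp.linearEquiv 2 ℂ (MultiIndex n q → Lp ℂ 2 (weightMeasure n))).symm.toLinearMap ∘ₗ
    LinearMap.pi fun J => testToL2 n ∘ₗ LinearMap.proj J

theorem testToL2_injective (n : ℕ) : Function.Injective (testToL2 n) := by
  intro f g h
  have h' : (f : (Fin n → ℂ) → ℂ) =ᵐ[weightMeasure n] g :=
    (MemLp.toLp_eq_toLp_iff f.memLp g.memLp).1 h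
  exact DFunLike.coe_injective
    (Continuous.ae_eq_iff_eq (weightMeasure n) f.contDiff.continuous g.contDiff.continuous |>.1 h')

theorem formToL2_injective (n q : ℕ) : Function.Injective (formToL2 n q) := by
  intro u v h
  funext J
  exact testToL2_injective n (congrArg (fun w : L2Form n q => w J) h)

/-! ### The `∂̄`-Neumann Laplacian -/

/-- The operator `∂̄ ∂̄*_φ + ∂̄*_φ ∂̄` in `L²_{(0,q)}(ℂⁿ, e^{-φ})`, with domain the forms with
coefficients in `C_0^∞(ℂⁿ)`. -/
def boxMin (n q : ℕ) : L2Form n q →ₗ.[ℂ] L2Form n q where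
  domain := LinearMap.range (formToL2 n q)
  toFun := formToL2 n q ∘ₗ boxTest n q ∘ₗ
    (LinearEquiv.ofInjective (formToL2 n q) (formToL2_injective n q)).symm.toLinearMap

/-- The weighted `∂̄`-Neumann Laplacian `□_{φ,q}`: the closure of the operator defined on forms with
coefficients in `C_0^∞(ℂⁿ)`. -/
def box (n q : ℕ) : L2Form n q →ₗ.[ℂ] L2Form n q := (boxMin n q).closure

/-! ### Spectrum and eigenspaces of an unbounded operator -/

/-- The resolvent set of an unbounded operator `A`: those `μ` for which
`A - μ : dom A → H` is bijective with a bounded inverse `R : H → dom A ⊆ H`. -/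
def resolventSet {H : Type*} [NormedAddCommGroup H] [NormedSpace ℂ H]
    (A : H →ₗ.[ℂ] H) : Set ℂ :=
  {μ | ∃ R : H →L[ℂ] H,
    (∀ x : H, ∃ h : R x ∈ A.domain, A ⟨R x, h⟩ - μ • R x = x) ∧
    ∀ u : A.domain, R (A u - μ • (u : H)) = u}

/-- The spectrum of an unbounded operator. -/
def spectrum {H : Type*} [NormedAddCommGroup H] [NormedSpace ℂ H]
    (A : H →ₗ.[ℂ] H) : Set ℂ := (resolventSet A)ᶜ

/-- The eigenspace `{u ∈ dom A : A u = μ u}` of an unbounded operator. -/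
def eigenspace {H : Type*} [NormedAddCommGroup H] [NormedSpace ℂ H]
    (A : H →ₗ.[ℂ] H) (μ : ℂ) : Submodule ℂ H :=
  (LinearMap.ker (A.toFun - μ • A.domain.subtype)).map A.domain.subtype

end FockDbar

end

/-! Write `N = -∑ δ_k ∂/∂z̄_k`. Exterior multiplication by `dz̄_j` and contraction with `dz̄_k`
satisfy the canonical anticommutation relations (`wedgeCoeff_anticomm`), and `[∂/∂z̄_j, δ_k] = -1`
if `j = k` and `0` otherwise (`dzbar_delta`). Hence all mixed terms of `∂̄∂̄* + ∂̄*∂̄` cancel, and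
the Laplacian acts on each coefficient as `N + q` (`boxTest_apply`); `q` counts the factors of
`dz̄_J`. What remains is the scalar operator `N`.

`N` preserves polynomials in `z` and `z̄`. There `z̄_j - ∂/∂z_j` raises the eigenvalue by one, while
`∂/∂z_j` and `z_j - ∂/∂z̄_j` commute with `N`. Starting from the constants, these operators show
that every polynomial is a sum of eigenvectors with eigenvalues `0, 1, 2, ...` (`iSup_landau`).

Three analytic facts transfer this to `L²`. Polynomials are dense, by uniqueness of Fourier
transforms of finite measures. Cutoffs place them in the domain of the closure
(`exists_testFun_tendsto_poly`). Integration by parts makes `N` symmetric on test functions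
(`inner_numTest`).

A closed symmetric operator with a total family of eigenvectors can be inverted eigenspace by
eigenspace at any `μ` at positive distance from the eigenvalues. This gives the resolvent set
(`IsSymmetricOperator.mem_resolventSet`) and, through surjectivity of `A + 1`, self-adjointness.
Infinite multiplicity comes from the eigenvectors `z̄_i^m p(z_j)` with `i ≠ j`, where `p` is an
arbitrary polynomial; two distinct coordinates exist because `n > 1`. -/

noncomputable section

namespace FockDbar

/-! ### Closed symmetric operators with a total family of eigenvectors -/

section Operators

open Filter Topology

variable {H : Type*} [NormedAddCommGroup H] [InnerProductSpace ℂ H]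

/-- A symmetric unbounded operator, in terms of its graph. -/
def IsSymmetricOperator (A : H →ₗ.[ℂ] H) : Prop :=
  ∀ x ∈ A.graph, ∀ y ∈ A.graph, inner ℂ x.2 y.1 = inner ℂ x.1 y.2

theorem mem_eigenspace_iff {A : H →ₗ.[ℂ] H} {μ : ℂ} {x : H} :
    x ∈ eigenspace A μ ↔ (x, μ • x) ∈ A.graph := by
  rw [LinearPMap.mem_graph_iff, eigenspace, Submodule.mem_map]
  refine exists_congr fun y => ?_
  simp only [LinearMap.mem_ker, LinearMap.sub_apply, LinearMap.smul_apply, Submodule.subtype_apply,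
    sub_eq_zero, LinearPMap.toFun_eq_coe]
  constructor
  · rintro ⟨h, rfl⟩
    exact ⟨rfl, h⟩
  · rintro ⟨rfl, h⟩
    exact ⟨h, rfl⟩

/-- Moving `A` across gives `r⟨x, y⟩ = μ⟨x, y⟩`. Only `r` has to be real, so the same lemma gives
orthogonality of the eigenspaces and, for arbitrary complex `μ`, injectivity of `A - μ`. -/
theorem IsSymmetricOperator.inner_eq_zero {A : H →ₗ.[ℂ] H} (hA : IsSymmetricOperator A)
    {r : ℝ} {μ : ℂ} (hr : (r : ℂ) ≠ μ) {x y : H} (hx : x ∈ eigenspace A (r : ℂ))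
    (hy : y ∈ eigenspace A μ) : inner ℂ x y = 0 := by
  have h := hA _ (mem_eigenspace_iff.1 hx) _ (mem_eigenspace_iff.1 hy)
  simp only [inner_smul_left, inner_smul_right, Complex.conj_ofReal] at h
  have h2 : ((r : ℂ) - μ) * inner ℂ x y = 0 := by rw [sub_mul, h, sub_self]
  exact (mul_eq_zero.1 h2).resolve_left (sub_ne_zero.2 hr)

theorem IsSymmetricOperator.orthogonalFamily {A : H →ₗ.[ℂ] H} (hA : IsSymmetricOperator A)
    {lam : ℕ → ℝ} (hlam : Function.Injective lam) :
    OrthogonalFamily ℂ (fun k => eigenspace A (lam k : ℂ))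
      fun k => (eigenspace A (lam k : ℂ)).subtypeₗᵢ := by
  intro i j hij x y
  exact hA.inner_eq_zero (fun h => hij (hlam (Complex.ofReal_injective h))) x.2 y.2

theorem IsSymmetricOperator.eq_zero_of_mem_eigenspace [CompleteSpace H] {A : H →ₗ.[ℂ] H}
    (hA : IsSymmetricOperator A) {lam : ℕ → ℝ}
    (hdense : (⨆ k, eigenspace A (lam k : ℂ)).topologicalClosure = ⊤) {μ : ℂ}
    (hμ : ∀ k, (lam k : ℂ) ≠ μ) {w : H} (hw : w ∈ eigenspace A μ) : w = 0 := by
  have h : w ∈ (⨆ k, eigenspace A (lam k : ℂ))ᗮ := by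
    rw [← Submodule.iInf_orthogonal, Submodule.mem_iInf]
    intro k
    rw [Submodule.mem_orthogonal]
    exact fun u hu => hA.inner_eq_zero (hμ k) hu hw
  rw [Submodule.topologicalClosure_eq_top_iff.1 hdense] at h
  simpa using h

/-- On a finite sum of eigenvectors, `(A - μ) w = u` is solved by dividing each component by `λ_k -
μ`; the norm bound is Pythagoras. Membership in the graph encodes the equation together with `w ∈
dom A`. -/
theorem IsSymmetricOperator.exists_solution_of_mem_iSup {A : H →ₗ.[ℂ] H}
    (hA : IsSymmetricOperator A) {lam : ℕ → ℝ} (hlam : Function.Injective lam) {μ : ℂ} {d : ℝ}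
    (hd : 0 < d) (hμ : ∀ k, d ≤ ‖(lam k : ℂ) - μ‖) {u : H}
    (hu : u ∈ ⨆ k, eigenspace A (lam k : ℂ)) :
    ∃ w, (w, u + μ • w) ∈ A.graph ∧ ‖w‖ ≤ d⁻¹ * ‖u‖ := by
  obtain ⟨f, hf, rfl⟩ := (Submodule.mem_iSup_iff_exists_finsupp _ _).1 hu
  have hne : ∀ k, (lam k : ℂ) - μ ≠ 0 := fun k h => by
    have := hμ k
    rw [h, norm_zero] at this
    exact absurd this (not_le.2 hd)
  let g : ∀ k, eigenspace A (lam k : ℂ) := fun k => ((lam k : ℂ) - μ)⁻¹ • ⟨f k, hf k⟩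
  refine ⟨∑ k ∈ f.support, (g k : H), ?_, ?_⟩
  · have : (∑ k ∈ f.support, (g k : H), (f.sum fun _ x => x) + μ • ∑ k ∈ f.support, (g k : H)) =
        ∑ k ∈ f.support, ((g k : H), (lam k : ℂ) • (g k : H)) := by
      rw [Finsupp.sum, Finset.smul_sum, ← Finset.sum_add_distrib]
      refine Prod.ext (by simp [Prod.fst_sum]) ?_
      simp only [Prod.snd_sum]
      refine Finset.sum_congr rfl fun k _ => ?_
      have h1 : f k = ((lam k : ℂ) - μ) • (g k : H) := by
        simp [g, smul_smul, mul_inv_cancel₀ (hne k)]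
      rw [h1, ← add_smul, sub_add_cancel]
    rw [this]
    exact Submodule.sum_mem _ fun k _ => mem_eigenspace_iff.1 (g k).2
  · have h1 := (hA.orthogonalFamily hlam).norm_sum g f.support
    have h2 := (hA.orthogonalFamily hlam).norm_sum (fun k => ⟨f k, hf k⟩) f.support
    change ‖∑ k ∈ f.support, (g k : H)‖ ^ 2 = ∑ k ∈ f.support, ‖g k‖ ^ 2 at h1
    change ‖∑ k ∈ f.support, f k‖ ^ 2 = ∑ k ∈ f.support, ‖f k‖ ^ 2 at h2
    rw [Finsupp.sum]
    refine le_of_sq_le_sq ?_ (by positivity)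
    rw [mul_pow, h1, h2, Finset.mul_sum]
    refine Finset.sum_le_sum fun k _ => ?_
    rw [← mul_pow]
    refine pow_le_pow_left₀ (norm_nonneg _) ?_ 2
    simp only [g, norm_smul, norm_inv]
    refine mul_le_mul ?_ le_rfl (norm_nonneg _) (by positivity)
    gcongr
    exact hμ k

/-- The uniform bound makes the solutions for approximating right-hand sides a Cauchy sequence, and
closedness of the graph passes to the limit. -/
theorem IsSymmetricOperator.exists_solution [CompleteSpace H] {A : H →ₗ.[ℂ] H}
    (hA : IsSymmetricOperator A) (hcl : A.IsClosed) {lam : ℕ → ℝ} (hlam : Function.Injective lam)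
    (hdense : (⨆ k, eigenspace A (lam k : ℂ)).topologicalClosure = ⊤) {μ : ℂ} {d : ℝ}
    (hd : 0 < d) (hμ : ∀ k, d ≤ ‖(lam k : ℂ) - μ‖) (u : H) :
    ∃ w, (w, u + μ • w) ∈ A.graph ∧ ‖w‖ ≤ d⁻¹ * ‖u‖ := by
  have hne : ∀ k, (lam k : ℂ) ≠ μ := fun k h => by
    have := hμ k
    rw [h, sub_self, norm_zero] at this
    exact absurd this (not_le.2 hd)
  have hu : u ∈ closure ((⨆ k, eigenspace A (lam k : ℂ) : Submodule ℂ H) : Set H) := by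
    rw [← Submodule.topologicalClosure_coe, hdense]
    trivial
  obtain ⟨v, hv, hlim⟩ := mem_closure_iff_seq_limit.1 hu
  choose w hw hwn using fun i => hA.exists_solution_of_mem_iSup hlam hd hμ (hv i)
  -- The chosen `w i` need not depend linearly on `v i`; injectivity of `A - μ` identifies `w i - w
  -- j` with the bounded solution for `v i - v j`.
  have hdiff : ∀ i j, ‖w i - w j‖ ≤ d⁻¹ * ‖v i - v j‖ := by
    intro i j
    obtain ⟨x, hx, hxn⟩ :=
      hA.exists_solution_of_mem_iSup hlam hd hμ (Submodule.sub_mem _ (hv i) (hv j))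
    have h0 : w i - w j - x ∈ eigenspace A μ := by
      rw [mem_eigenspace_iff]
      convert A.graph.sub_mem (A.graph.sub_mem (hw i) (hw j)) hx using 1
      refine Prod.ext rfl ?_
      simp only [Prod.snd_sub, smul_sub]
      abel
    rw [sub_eq_zero.1 (hA.eq_zero_of_mem_eigenspace hdense hne h0)]
    exact hxn
  have hcauchy : CauchySeq w := by
    rw [Metric.cauchySeq_iff']
    intro ε hε
    obtain ⟨N, hN⟩ := Metric.cauchySeq_iff'.1 hlim.cauchySeq (d * ε) (by positivity)
    refine ⟨N, fun m hm => ?_⟩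
    have := hN m hm
    rw [dist_eq_norm] at this ⊢
    calc ‖w m - w N‖ ≤ d⁻¹ * ‖v m - v N‖ := hdiff m N
      _ < d⁻¹ * (d * ε) := by gcongr
      _ = ε := by field_simp
  obtain ⟨w₀, hw₀⟩ := cauchySeq_tendsto_of_complete hcauchy
  refine ⟨w₀, ?_, ?_⟩
  · exact IsClosed.mem_of_tendsto hcl
      (hw₀.prodMk_nhds (hlim.add (hw₀.const_smul μ))) (Eventually.of_forall hw)
  · exact le_of_tendsto_of_tendsto' hw₀.norm (hlim.norm.const_mul _) hwn

theorem IsSymmetricOperator.mem_resolventSet [CompleteSpace H] {A : H →ₗ.[ℂ] H}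
    (hA : IsSymmetricOperator A) (hcl : A.IsClosed) {lam : ℕ → ℝ} (hlam : Function.Injective lam)
    (hdense : (⨆ k, eigenspace A (lam k : ℂ)).topologicalClosure = ⊤) {μ : ℂ} {d : ℝ}
    (hd : 0 < d) (hμ : ∀ k, d ≤ ‖(lam k : ℂ) - μ‖) : μ ∈ resolventSet A := by
  have hne : ∀ k, (lam k : ℂ) ≠ μ := fun k h => by
    have := hμ k
    rw [h, sub_self, norm_zero] at this
    exact absurd this (not_le.2 hd)
  choose R hR hRn using hA.exists_solution hcl hlam hdense hd hμ
  -- Uniqueness of solutions yields both the linearity of `R` and the identity `R (A - μ) = 1`.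
  have huniq : ∀ u w, (w, u + μ • w) ∈ A.graph → w = R u := by
    intro u w h
    refine sub_eq_zero.1 (hA.eq_zero_of_mem_eigenspace hdense hne ?_)
    rw [mem_eigenspace_iff]
    convert A.graph.sub_mem h (hR u) using 1
    refine Prod.ext rfl ?_
    simp only [Prod.snd_sub, smul_sub]
    abel
  let L : H →ₗ[ℂ] H :=
    { toFun := R
      map_add' := fun x y => by
        refine (huniq _ _ ?_).symm
        convert A.graph.add_mem (hR x) (hR y) using 1
        refine Prod.ext rfl ?_
        simp only [Prod.snd_add, smul_add]
        abel
      map_smul' := fun c x => by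
        refine (huniq _ _ ?_).symm
        convert A.graph.smul_mem c (hR x) using 1
        refine Prod.ext rfl ?_
        simp only [Prod.smul_snd, smul_add, RingHom.id_apply]
        rw [smul_comm c μ] }
  refine ⟨L.mkContinuous d⁻¹ hRn, fun x => ?_, fun u => ?_⟩
  · obtain ⟨y, hy1, hy2⟩ := (LinearPMap.mem_graph_iff A).1 (hR x)
    dsimp only at hy1 hy2
    have hmem : R x ∈ A.domain := hy1 ▸ y.2
    refine ⟨hmem, ?_⟩
    have : (⟨R x, hmem⟩ : A.domain) = y := Subtype.ext hy1.symm
    change A ⟨R x, hmem⟩ - μ • R x = x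
    rw [this, hy2, add_sub_cancel_right]
  · refine (huniq _ _ ?_).symm
    rw [sub_add_cancel]
    exact A.mem_graph u

theorem eigenspace_eq_bot_of_mem_resolventSet {A : H →ₗ.[ℂ] H} {μ : ℂ}
    (hμ : μ ∈ resolventSet A) : eigenspace A μ = ⊥ := by
  obtain ⟨R, -, hR⟩ := hμ
  refine (Submodule.eq_bot_iff _).2 fun x hx => ?_
  obtain ⟨y, rfl, hy⟩ := (LinearPMap.mem_graph_iff A).1 (mem_eigenspace_iff.1 hx)
  have := hR y
  dsimp only at hy
  rw [hy, sub_self, map_zero] at this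
  exact this.symm

/-- A closed symmetric operator that has a total family of eigenvectors with nonnegative
eigenvalues is self-adjoint. -/
theorem IsSymmetricOperator.isSelfAdjoint [CompleteSpace H] {A : H →ₗ.[ℂ] H}
    (hA : IsSymmetricOperator A) (hcl : A.IsClosed) {lam : ℕ → ℝ} (hlam : Function.Injective lam)
    (hdense : (⨆ k, eigenspace A (lam k : ℂ)).topologicalClosure = ⊤) (hpos : ∀ k, 0 ≤ lam k) :
    IsSelfAdjoint A := by
  -- The point `-1` has distance at least `1` from all eigenvalues, so `A + 1` is onto.
  have hbound : ∀ k, (1 : ℝ) ≤ ‖(lam k : ℂ) - (-1 : ℂ)‖ := by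
    intro k
    rw [sub_neg_eq_add, ← Complex.ofReal_one, ← Complex.ofReal_add, Complex.norm_real,
      Real.norm_of_nonneg (add_nonneg (hpos k) zero_le_one)]
    linarith [hpos k]
  have hsol := hA.exists_solution hcl hlam hdense one_pos hbound
  have hdom : Dense (A.domain : Set H) := by
    have h1 : (⨆ k, eigenspace A (lam k : ℂ)) ≤ A.domain :=
      iSup_le fun k x hx => LinearPMap.mem_domain_of_mem_graph (mem_eigenspace_iff.1 hx)
    rw [Submodule.dense_iff_topologicalClosure_eq_top, eq_top_iff, ← hdense]
    exact Submodule.topologicalClosure_mono h1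
  rw [LinearPMap.isSelfAdjoint_def]
  refine le_antisymm ?_ (LinearPMap.IsFormalAdjoint.le_adjoint hdom fun x y =>
    hA _ (A.mem_graph x) _ (A.mem_graph y))
  -- For `p = (y, A* y)`, solve `(A + 1) w = A* y + y`. Then `y - w` is orthogonal to the range of
  -- `A + 1`, which is everything, so `y = w` lies in the domain of `A`.
  refine LinearPMap.le_of_le_graph fun p hp => ?_
  obtain ⟨y, hy1, hy2⟩ := (LinearPMap.mem_graph_iff _).1 hp
  obtain ⟨w, hw, -⟩ := hsol (p.2 + p.1)
  have hw' : (w, p.2 + p.1 - w) ∈ A.graph := by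
    convert hw using 2
    rw [neg_one_smul, sub_eq_add_neg]
  have heq : p.1 - w = 0 := by
    obtain ⟨x, hx, -⟩ := hsol (p.1 - w)
    have h1 := hA _ hx _ hw'
    obtain ⟨x', hx1, hx2⟩ := (LinearPMap.mem_graph_iff _).1 hx
    have h2 := LinearPMap.adjoint_isFormalAdjoint hdom y x'
    rw [hx1, hx2, hy2, hy1] at h2
    have h2' := congrArg (starRingEnd ℂ) h2
    rw [inner_conj_symm, inner_conj_symm] at h2'
    dsimp only at h1 h2'
    rw [← inner_self_eq_zero (𝕜 := ℂ)]
    have h3 : inner ℂ (p.1 - w + (-1 : ℂ) • x) (p.1 - w) = inner ℂ x (w - p.1) := by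
      rw [inner_sub_right, h1, ← h2', ← inner_sub_right]
      congr 1
      abel
    rw [inner_add_left, neg_one_smul, inner_neg_left, ← neg_sub p.1 w, inner_neg_right] at h3
    exact add_right_cancel (h3.trans (zero_add _).symm)
  have : p = (w, p.2 + p.1 - w) := by
    refine Prod.ext (sub_eq_zero.1 heq) ?_
    rw [add_sub_assoc, heq, add_zero]
  rw [this]
  exact hw'

/-- A densely defined symmetric operator is contained in its adjoint, which is closed. -/
theorem IsSymmetricOperator.isClosable [CompleteSpace H] {A : H →ₗ.[ℂ] H}
    (hA : IsSymmetricOperator A) (hdom : Dense (A.domain : Set H)) : A.IsClosable :=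
  (LinearPMap.adjoint_isClosed hdom).isClosable.leIsClosable
    (LinearPMap.IsFormalAdjoint.le_adjoint hdom fun x y => hA _ (A.mem_graph x) _ (A.mem_graph y))

/-- The symmetry identity is extended by continuity in one variable at a time. -/
theorem IsSymmetricOperator.closure {A : H →ₗ.[ℂ] H} (hA : IsSymmetricOperator A)
    (hcl : A.IsClosable) : IsSymmetricOperator A.closure := by
  have h1 : ∀ x ∈ A.graph.topologicalClosure, ∀ y ∈ A.graph,
      inner ℂ x.2 y.1 = inner ℂ x.1 y.2 := by
    intro x hx y hy
    have hc : IsClosed {x : H × H | inner ℂ x.2 y.1 = inner ℂ x.1 y.2} :=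
      isClosed_eq (by fun_prop) (by fun_prop)
    exact closure_minimal (fun x hx => hA x hx y hy) hc hx
  intro x hx y hy
  rw [← hcl.graph_closure_eq_closure_graph] at hx hy
  have hc : IsClosed {y : H × H | inner ℂ x.2 y.1 = inner ℂ x.1 y.2} :=
    isClosed_eq (by fun_prop) (by fun_prop)
  exact closure_minimal (fun y hy => h1 x hx y hy) hc hy

end Operators

/-! ### The box operator acts diagonally -/

/-- Only `K = L \ {j}` contributes. The sum runs over all subsets rather than those of a fixed size,
so the anticommutation relations need no degree bookkeeping; `sum_multiIndex` restores the degree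
later. -/
theorem sum_wedgeCoeff_mul {n : ℕ} (j : Fin n) (L : Finset (Fin n)) (F : Finset (Fin n) → ℂ) :
    ∑ K, wedgeCoeff j K L * F K =
      if j ∈ L then (-1) ^ (L.filter (· < j)).card * F (L.erase j) else 0 := by
  split_ifs with h
  · rw [Finset.sum_eq_single (L.erase j)]
    · simp [wedgeCoeff, h, Finset.filter_erase]
    · intro K _ hK
      rw [wedgeCoeff, if_neg, zero_mul]
      rintro ⟨h1, rfl⟩
      exact hK (Finset.erase_insert h1).symm
    · simp
  · refine Finset.sum_eq_zero fun K _ => ?_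
    rw [wedgeCoeff, if_neg, zero_mul]
    rintro ⟨-, rfl⟩
    exact h (Finset.mem_insert_self _ _)

theorem sum_wedgeCoeff_mul' {n : ℕ} (k : Fin n) (L : Finset (Fin n)) (F : Finset (Fin n) → ℂ) :
    ∑ M, wedgeCoeff k L M * F M =
      if k ∉ L then (-1) ^ (L.filter (· < k)).card * F (insert k L) else 0 := by
  by_cases h : k ∈ L
  rotate_left
  · rw [if_pos h, Finset.sum_eq_single (insert k L)]
    · simp [wedgeCoeff, h]
    · intro K _ hK
      rw [wedgeCoeff, if_neg, zero_mul]
      rintro ⟨h1, rfl⟩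
      exact hK rfl
    · simp
  · rw [if_neg (not_not.2 h)]
    refine Finset.sum_eq_zero fun K _ => ?_
    rw [wedgeCoeff, if_neg (fun h' => h'.1 h), zero_mul]

theorem card_filter_insert {n : ℕ} {j k : Fin n} {L : Finset (Fin n)} (hk : k ∉ L) :
    ((insert k L).filter (· < j)).card = (L.filter (· < j)).card + if k < j then 1 else 0 := by
  rw [Finset.filter_insert]
  split_ifs with h
  · rw [Finset.card_insert_of_notMem (by simp [hk])]
  · rw [add_zero]

/-- The canonical anticommutation relations for exterior multiplication by `dz̄_j` and its
adjoint. -/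
theorem wedgeCoeff_anticomm {n : ℕ} (j k : Fin n) (L J : Finset (Fin n)) :
    ∑ K, wedgeCoeff j K L * wedgeCoeff k K J + ∑ M, wedgeCoeff k L M * wedgeCoeff j J M =
      if j = k ∧ J = L then 1 else 0 := by
  rw [sum_wedgeCoeff_mul j L (fun K => wedgeCoeff k K J),
    sum_wedgeCoeff_mul' k L (fun M => wedgeCoeff j J M)]
  by_cases hjk : j = k
  · subst hjk
    by_cases hj : j ∈ L
    · simp only [hj, if_true, not_true, if_false, add_zero, wedgeCoeff, Finset.notMem_erase,
        not_false_eq_true, true_and, Finset.insert_erase hj, Finset.filter_erase]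
      rw [Finset.erase_eq_of_notMem (by simp)]
      by_cases hL : L = J
      · simp [hL, ← mul_pow]
      · simp [hL, Ne.symm hL]
    · simp only [hj, if_false, zero_add, not_false_eq_true, if_true, wedgeCoeff]
      by_cases hL : J = L
      · simp [hL, hj, ← mul_pow]
      · rw [if_neg, mul_zero, if_neg (by simp [hL])]
        rintro ⟨h1, h2⟩
        apply hL
        rw [← Finset.erase_insert h1, h2, Finset.erase_insert hj]
  · rw [if_neg (show ¬(j = k ∧ J = L) from fun h => hjk h.1)]
    by_cases hj : j ∈ L
    · by_cases hk : k ∈ L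
      · rw [if_pos hj, if_neg (by simpa using hk), wedgeCoeff, if_neg]
        · simp
        · simp [hk, Ne.symm hjk]
      · rw [if_pos hj, if_pos hk]
        by_cases hJ : J = insert k (L.erase j)
        · have h1 : j ∉ J := by simp [hJ, hjk]
          have h2 : insert j J = insert k L := by
            rw [hJ, Finset.insert_comm, Finset.insert_erase hj]
          have hk' : k ∉ L.erase j := by simp [hk]
          have hL : L = insert j (L.erase j) := (Finset.insert_erase hj).symm
          have hj' : j ∉ L.erase j := by simp
          rw [wedgeCoeff, if_pos ⟨hk', hJ.symm⟩, wedgeCoeff, if_pos ⟨h1, h2⟩]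
          rw [hJ, card_filter_insert hk']
          -- Both signs are compared with counts in `L \ {j}`. Restoring `j` changes the count below
          -- `k` exactly when `j < k`, and inserting `k` changes the count below `j` exactly when `k
          -- < j`. Exactly one of these happens, so the two terms cancel.
          have e1 : (L.filter (· < j)).card = ((L.erase j).filter (· < j)).card := by
            conv_lhs => rw [hL, card_filter_insert hj']
            simp
          have e2 : (L.filter (· < k)).card =
              ((L.erase j).filter (· < k)).card + if j < k then 1 else 0 := by
            conv_lhs => rw [hL, card_filter_insert hj']
          rw [e1, e2]
          rcases lt_or_gt_of_ne hjk with h | h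
          · rw [if_pos h, if_neg (not_lt.2 h.le)]
            ring
          · rw [if_pos h, if_neg (not_lt.2 h.le)]
            ring
        · rw [wedgeCoeff, if_neg (fun h => hJ h.2.symm), wedgeCoeff, if_neg]
          · simp
          · rintro ⟨h1, h2⟩
            apply hJ
            rw [← Finset.erase_insert h1, h2, Finset.erase_insert_of_ne (Ne.symm hjk)]
    · rw [if_neg hj, zero_add]
      by_cases hk : k ∈ L
      · rw [if_neg (not_not.2 hk)]
      · rw [if_pos hk, wedgeCoeff, if_neg, mul_zero]
        rintro ⟨h1, h2⟩
        have : j ∈ insert k L := h2 ▸ Finset.mem_insert_self _ _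
        simp [hjk, hj] at this

theorem sum_multiIndex {n q : ℕ} {M : Type*} [AddCommMonoid M] (F : Finset (Fin n) → M)
    (hF : ∀ K, F K ≠ 0 → K.card = q) : ∑ K : MultiIndex n q, F K.1 = ∑ K, F K := by
  classical
  rw [← Finset.sum_filter_of_ne fun K _ h => hF K h]
  exact (Finset.sum_subtype _ (by simp) F).symm

theorem card_of_wedgeCoeff_ne_zero {n : ℕ} {j : Fin n} {J K : Finset (Fin n)}
    (h : wedgeCoeff j J K ≠ 0) : K.card = J.card + 1 := by
  rw [wedgeCoeff] at h
  split_ifs at h with h1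
  · rw [← h1.2, Finset.card_insert_of_notMem h1.1]
  · exact absurd rfl h

/-! ### Calculus of the Wirtinger derivatives -/

section Calculus

variable {n : ℕ} {f g : (Fin n → ℂ) → ℂ} {z : Fin n → ℂ}

theorem dz_add (k : Fin n) (hf : DifferentiableAt ℝ f z) (hg : DifferentiableAt ℝ g z) :
    dz k (fun w => f w + g w) z = dz k f z + dz k g z := by
  simp only [dz, fderiv_fun_add hf hg, add_apply]
  ring

theorem dzbar_add (k : Fin n) (hf : DifferentiableAt ℝ f z) (hg : DifferentiableAt ℝ g z) :
    dzbar k (fun w => f w + g w) z = dzbar k f z + dzbar k g z := by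
  simp only [dzbar, fderiv_fun_add hf hg, add_apply]
  ring

theorem dz_mul (k : Fin n) (hf : DifferentiableAt ℝ f z) (hg : DifferentiableAt ℝ g z) :
    dz k (fun w => f w * g w) z = dz k f z * g z + f z * dz k g z := by
  simp only [dz, fderiv_fun_mul hf hg, add_apply, smul_apply, smul_eq_mul]
  ring

theorem dzbar_mul (k : Fin n) (hf : DifferentiableAt ℝ f z) (hg : DifferentiableAt ℝ g z) :
    dzbar k (fun w => f w * g w) z = dzbar k f z * g z + f z * dzbar k g z := by
  simp only [dzbar, fderiv_fun_mul hf hg, add_apply, smul_apply, smul_eq_mul]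
  ring

theorem dz_const (k : Fin n) (c : ℂ) : dz k (fun _ : Fin n → ℂ => c) z = 0 := by
  simp [dz]

theorem dzbar_const (k : Fin n) (c : ℂ) : dzbar k (fun _ : Fin n → ℂ => c) z = 0 := by
  simp [dzbar]

theorem fderiv_coord (j : Fin n) :
    fderiv ℝ (fun w : Fin n → ℂ => w j) z = ContinuousLinearMap.proj j :=
  (ContinuousLinearMap.proj (R := ℝ) (φ := fun _ : Fin n => ℂ) j).fderiv

theorem fderiv_conj_coord (j : Fin n) :
    fderiv ℝ (fun w : Fin n → ℂ => starRingEnd ℂ (w j)) z =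
      (Complex.conjCLE : ℂ →L[ℝ] ℂ).comp (ContinuousLinearMap.proj j) :=
  ((Complex.conjCLE : ℂ →L[ℝ] ℂ).comp
    (ContinuousLinearMap.proj (R := ℝ) (φ := fun _ : Fin n => ℂ) j)).fderiv

theorem dz_coord (k j : Fin n) :
    dz k (fun w : Fin n → ℂ => w j) z = if j = k then 1 else 0 := by
  rw [dz, fderiv_coord]
  split_ifs with h
  · subst h
    simp
    norm_num
  · simp [h]

theorem dzbar_coord (k j : Fin n) : dzbar k (fun w : Fin n → ℂ => w j) z = 0 := by
  rw [dzbar, fderiv_coord]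
  by_cases h : j = k
  · subst h
    simp
  · simp [h]

theorem dz_conj_coord (k j : Fin n) :
    dz k (fun w : Fin n → ℂ => starRingEnd ℂ (w j)) z = 0 := by
  rw [dz, fderiv_conj_coord]
  by_cases h : j = k
  · subst h
    simp
  · simp [h]

theorem dzbar_conj_coord (k j : Fin n) :
    dzbar k (fun w : Fin n → ℂ => starRingEnd ℂ (w j)) z = if j = k then 1 else 0 := by
  rw [dzbar, fderiv_conj_coord]
  split_ifs with h
  · subst h
    simp
    norm_num
  · simp [h]

theorem fderiv_fderiv_apply (hf : ContDiff ℝ ∞ f) (v w : Fin n → ℂ) :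
    fderiv ℝ (fun y => fderiv ℝ f y v) z w = fderiv ℝ (fderiv ℝ f) z w v := by
  have h : DifferentiableAt ℝ (fderiv ℝ f) z :=
    (hf.fderiv_right (m := ∞) (by simp)).differentiable (by simp) z
  rw [fderiv_clm_apply h (differentiableAt_const v)]
  simp

theorem differentiableAt_fderiv_apply (hf : ContDiff ℝ ∞ f) (v : Fin n → ℂ) :
    DifferentiableAt ℝ (fun y => fderiv ℝ f y v) z :=
  ((hf.fderiv_right (m := ∞) (by simp)).differentiable (by simp) z).clm_apply
    (differentiableAt_const v)

theorem fderiv_dz (k : Fin n) (hf : ContDiff ℝ ∞ f) (w : Fin n → ℂ) :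
    fderiv ℝ (dz k f) z w = (1 / 2 : ℂ) * (fderiv ℝ (fderiv ℝ f) z w (Pi.single k 1) -
      Complex.I * fderiv ℝ (fderiv ℝ f) z w (Pi.single k Complex.I)) := by
  have h1 := differentiableAt_fderiv_apply (z := z) hf (Pi.single k 1)
  have h2 := differentiableAt_fderiv_apply (z := z) hf (Pi.single k Complex.I)
  unfold dz
  rw [fderiv_const_mul (h1.fun_sub (h2.const_mul _)), fderiv_fun_sub h1 (h2.const_mul _),
    fderiv_const_mul h2]
  simp only [smul_apply, sub_apply, smul_eq_mul, fderiv_fderiv_apply hf]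

theorem fderiv_dzbar (k : Fin n) (hf : ContDiff ℝ ∞ f) (w : Fin n → ℂ) :
    fderiv ℝ (dzbar k f) z w = (1 / 2 : ℂ) * (fderiv ℝ (fderiv ℝ f) z w (Pi.single k 1) +
      Complex.I * fderiv ℝ (fderiv ℝ f) z w (Pi.single k Complex.I)) := by
  have h1 := differentiableAt_fderiv_apply (z := z) hf (Pi.single k 1)
  have h2 := differentiableAt_fderiv_apply (z := z) hf (Pi.single k Complex.I)
  unfold dzbar
  rw [fderiv_const_mul (h1.fun_add (h2.const_mul _)), fderiv_fun_add h1 (h2.const_mul _),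
    fderiv_const_mul h2]
  simp only [smul_apply, add_apply, smul_eq_mul, fderiv_fderiv_apply hf]

theorem dzbar_dz_comm (j k : Fin n) (hf : ContDiff ℝ ∞ f) :
    dzbar j (dz k f) z = dz k (dzbar j f) z := by
  have hs : IsSymmSndFDerivAt ℝ f z := hf.contDiffAt.isSymmSndFDerivAt (by
    simp only [minSmoothness_of_isRCLikeNormedField]
    exact WithTop.coe_le_coe.2 (le_top : (2 : ℕ∞) ≤ ⊤))
  rw [dzbar, dz]
  simp only [fderiv_dz k hf, fderiv_dzbar j hf]
  rw [hs (Pi.single j 1) (Pi.single k 1), hs (Pi.single j 1) (Pi.single k Complex.I),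
    hs (Pi.single j Complex.I) (Pi.single k 1),
    hs (Pi.single j Complex.I) (Pi.single k Complex.I)]
  ring

end Calculus

/-! ### Polynomials in `z` and `z̄` -/

/-- Polynomials in the variables `z_j` and `z̄_j`. -/
abbrev RealPoly (n : ℕ) : Type := MvPolynomial (Fin n ⊕ Fin n) ℂ

/-- The function defined by a polynomial in `z` and `z̄`. -/
def evalPoly {n : ℕ} (P : RealPoly n) (z : Fin n → ℂ) : ℂ :=
  MvPolynomial.eval (Sum.elim z fun j => starRingEnd ℂ (z j)) P

section Poly

open MvPolynomial

variable {n : ℕ}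

theorem evalPoly_X_inl (j : Fin n) : evalPoly (X (Sum.inl j)) = fun z => z j := by
  ext z
  simp [evalPoly]

theorem evalPoly_X_inr (j : Fin n) :
    evalPoly (X (Sum.inr j)) = fun z => starRingEnd ℂ (z j) := by
  ext z
  simp [evalPoly]

theorem evalPoly_C (c : ℂ) : evalPoly (C c : RealPoly n) = fun _ => c := by
  ext z
  simp [evalPoly]

theorem evalPoly_add (P Q : RealPoly n) :
    evalPoly (P + Q) = fun z => evalPoly P z + evalPoly Q z := by
  ext z
  simp [evalPoly]

theorem evalPoly_mul (P Q : RealPoly n) :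
    evalPoly (P * Q) = fun z => evalPoly P z * evalPoly Q z := by
  ext z
  simp [evalPoly]

theorem contDiff_evalPoly (P : RealPoly n) : ContDiff ℝ ∞ (evalPoly P) := by
  induction P using MvPolynomial.induction_on with
  | C c => rw [evalPoly_C]; exact contDiff_const
  | add P Q hP hQ => rw [evalPoly_add]; exact hP.add hQ
  | mul_X P i hP =>
    rw [evalPoly_mul]
    refine hP.mul ?_
    rcases i with j | j
    · rw [evalPoly_X_inl]
      exact contDiff_apply ℝ ℂ j
    · rw [evalPoly_X_inr]
      exact Complex.conjCLE.contDiff.comp (contDiff_apply ℝ ℂ j)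

theorem differentiableAt_evalPoly (P : RealPoly n) (z : Fin n → ℂ) :
    DifferentiableAt ℝ (evalPoly P) z :=
  (contDiff_evalPoly P).differentiable (by simp) z

theorem dz_evalPoly (k : Fin n) (P : RealPoly n) :
    dz k (evalPoly P) = evalPoly (pderiv (Sum.inl k) P) := by
  ext z
  induction P using MvPolynomial.induction_on with
  | C c => rw [evalPoly_C, dz_const, pderiv_C]; simp [evalPoly]
  | add P Q hP hQ =>
    rw [evalPoly_add, dz_add k (differentiableAt_evalPoly P z) (differentiableAt_evalPoly Q z),
      hP, hQ, map_add, evalPoly_add]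
  | mul_X P i hP =>
    rw [evalPoly_mul, dz_mul k (differentiableAt_evalPoly P z) (differentiableAt_evalPoly _ z),
      hP, pderiv_mul, evalPoly_add, evalPoly_mul, evalPoly_mul]
    congr 2
    rcases i with j | j
    · rw [evalPoly_X_inl, dz_coord, pderiv_X]
      by_cases h : j = k <;> simp [h, evalPoly]
    · rw [evalPoly_X_inr, dz_conj_coord, pderiv_X]
      simp [evalPoly]

theorem dzbar_evalPoly (k : Fin n) (P : RealPoly n) :
    dzbar k (evalPoly P) = evalPoly (pderiv (Sum.inr k) P) := by
  ext z
  induction P using MvPolynomial.induction_on with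
  | C c => rw [evalPoly_C, dzbar_const, pderiv_C]; simp [evalPoly]
  | add P Q hP hQ =>
    rw [evalPoly_add, dzbar_add k (differentiableAt_evalPoly P z) (differentiableAt_evalPoly Q z),
      hP, hQ, map_add, evalPoly_add]
  | mul_X P i hP =>
    rw [evalPoly_mul, dzbar_mul k (differentiableAt_evalPoly P z) (differentiableAt_evalPoly _ z),
      hP, pderiv_mul, evalPoly_add, evalPoly_mul, evalPoly_mul]
    congr 2
    rcases i with j | j
    · rw [evalPoly_X_inl, dzbar_coord, pderiv_X]
      simp [evalPoly]
    · rw [evalPoly_X_inr, dzbar_conj_coord, pderiv_X]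
      by_cases h : j = k <;> simp [h, evalPoly]

theorem weight_eq_evalPoly (z : Fin n → ℂ) :
    (weight z : ℂ) = evalPoly (∑ j, X (Sum.inl j) * X (Sum.inr j) : RealPoly n) z := by
  simp [evalPoly, weight, Complex.mul_conj, Complex.normSq_eq_norm_sq]

theorem dz_weight (k : Fin n) (z : Fin n → ℂ) :
    dz k (fun w => (weight w : ℂ)) z = starRingEnd ℂ (z k) := by
  rw [funext weight_eq_evalPoly, dz_evalPoly]
  simp [evalPoly, pderiv_X, Pi.single_apply]

theorem delta_apply (k : Fin n) (f : (Fin n → ℂ) → ℂ) (z : Fin n → ℂ) :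
    delta k f z = dz k f z - starRingEnd ℂ (z k) * f z := by
  rw [delta, dz_weight]

/-- The commutator is minus the mixed derivative `∂²φ/∂z̄_j∂z_k`, which for this weight is the
identity matrix. -/
theorem dzbar_delta (j k : Fin n) {f : (Fin n → ℂ) → ℂ} (hf : ContDiff ℝ ∞ f) (z : Fin n → ℂ) :
    dzbar j (delta k f) z = delta k (dzbar j f) z - if j = k then f z else 0 := by
  have hz : DifferentiableAt ℝ (fun w : Fin n → ℂ => starRingEnd ℂ (w k)) z := by
    rw [← evalPoly_X_inr]
    exact differentiableAt_evalPoly _ _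
  have hd : Differentiable ℝ f := hf.differentiable (by simp)
  have h1 : delta k f = fun w => dz k f w + (-1 : ℂ) * (starRingEnd ℂ (w k) * f w) := by
    ext w
    rw [delta_apply]
    ring
  rw [h1, dzbar_add j ((contDiff_dz k hf).differentiable (by simp) z)
    ((hz.fun_mul (hd z)).const_mul _), dzbar_mul j (differentiableAt_const _) (hz.fun_mul (hd z)),
    dzbar_mul j hz (hd z), dzbar_const, dzbar_conj_coord, dzbar_dz_comm j k hf, delta_apply]
  by_cases h : j = k
  · rw [if_pos h, if_pos h.symm]
    ring
  · rw [if_neg h, if_neg (Ne.symm h)]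
    ring

end Poly

/-! ### The Laplacian on the coefficients of a test form. -/

theorem dzbarTest_deltaTest {n : ℕ} (j k : Fin n) (f : TestFun n) :
    dzbarTest j (deltaTest k f) = deltaTest k (dzbarTest j f) - if j = k then f else 0 := by
  ext z
  refine (dzbar_delta j k f.contDiff z).trans ?_
  split_ifs <;> rfl

/-- The scalar operator `-∑_k δ_k ∂/∂z̄_k` on test functions. -/
def numTest (n : ℕ) : TestFun n →ₗ[ℂ] TestFun n :=
  -∑ k : Fin n, deltaTest k ∘ₗ dzbarTest k

theorem dbar_apply {n q : ℕ} (u : TestForm n q) (K : MultiIndex n (q + 1)) :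
    dbar n q u K = ∑ j : Fin n, ∑ J : MultiIndex n q, wedgeCoeff j J.1 K.1 • dzbarTest j (u J) := by
  rw [Finset.sum_comm]
  simp [dbar]

theorem dbarStar_apply {n q : ℕ} (u : TestForm n (q + 1)) (K : MultiIndex n q) :
    dbarStar n q u K = -∑ k : Fin n, ∑ J : MultiIndex n (q + 1),
      wedgeCoeff k K.1 J.1 • deltaTest k (u J) := by
  simp [dbarStar]

theorem sum_multiIndex_mul_above {n q : ℕ} (j k : Fin n) (L J : MultiIndex n q) :
    ∑ M : MultiIndex n (q + 1), wedgeCoeff k L.1 M.1 * wedgeCoeff j J.1 M.1 =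
      ∑ M, wedgeCoeff k L.1 M * wedgeCoeff j J.1 M :=
  sum_multiIndex (fun M => wedgeCoeff k L.1 M * wedgeCoeff j J.1 M) fun K hK => by
    rw [card_of_wedgeCoeff_ne_zero (left_ne_zero_of_mul hK), L.2]

theorem sum_multiIndex_mul_below {n q : ℕ} (j k : Fin n) (L J : MultiIndex n (q + 1)) :
    ∑ K : MultiIndex n q, wedgeCoeff j K.1 L.1 * wedgeCoeff k K.1 J.1 =
      ∑ K, wedgeCoeff j K L.1 * wedgeCoeff k K J.1 :=
  sum_multiIndex (fun K => wedgeCoeff j K L.1 * wedgeCoeff k K J.1) fun K hK => by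
    have := card_of_wedgeCoeff_ne_zero (left_ne_zero_of_mul hK)
    rw [L.2] at this
    omega

/-- This and `dbar_dbarStar` bring the two compositions to the same triple sum over `k`, `j`, `J`,
so that `wedgeCoeff_anticomm` applies term by term. -/
theorem dbarStar_dbar {n q : ℕ} (u : TestForm n q) (L : MultiIndex n q) :
    dbarStar n q (dbar n q u) L = -∑ k : Fin n, ∑ j : Fin n, ∑ J : MultiIndex n q,
      (∑ M, wedgeCoeff k L.1 M * wedgeCoeff j J.1 M) • deltaTest k (dzbarTest j (u J)) := by
  rw [dbarStar_apply]
  congr 1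
  refine Finset.sum_congr rfl fun k _ => ?_
  simp_rw [dbar_apply, map_sum, map_smul, Finset.smul_sum, smul_smul]
  rw [Finset.sum_comm]
  refine Finset.sum_congr rfl fun j _ => ?_
  rw [Finset.sum_comm]
  refine Finset.sum_congr rfl fun J _ => ?_
  rw [← Finset.sum_smul, sum_multiIndex_mul_above]

theorem dbar_dbarStar {n q : ℕ} (u : TestForm n (q + 1)) (L : MultiIndex n (q + 1)) :
    dbar n q (dbarStar n q u) L = -∑ k : Fin n, ∑ j : Fin n, ∑ J : MultiIndex n (q + 1),
      (∑ K, wedgeCoeff j K L.1 * wedgeCoeff k K J.1) • dzbarTest j (deltaTest k (u J)) := by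
  conv_rhs => rw [Finset.sum_comm]
  rw [dbar_apply, ← Finset.sum_neg_distrib]
  refine Finset.sum_congr rfl fun j _ => ?_
  simp_rw [dbarStar_apply, map_neg, map_sum, map_smul, smul_neg, Finset.smul_sum, smul_smul]
  rw [Finset.sum_neg_distrib, Finset.sum_comm]
  congr 1
  refine Finset.sum_congr rfl fun k _ => ?_
  rw [Finset.sum_comm]
  refine Finset.sum_congr rfl fun J _ => ?_
  rw [← Finset.sum_smul, sum_multiIndex_mul_below]

/-- Contracting with `dz̄_k` and multiplying back is the projection onto the forms containing
`dz̄_k`; summing over `k` counts the degree. This is the source of the shift by `q`. -/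
theorem sum_wedgeCoeff_diag {n : ℕ} (L J : Finset (Fin n)) :
    ∑ k : Fin n, ∑ K, wedgeCoeff k K L * wedgeCoeff k K J = if J = L then (L.card : ℂ) else 0 := by
  have h : ∀ k, ∑ K, wedgeCoeff k K L * wedgeCoeff k K J =
      if k ∈ L then (if J = L then 1 else 0) else 0 := by
    intro k
    rw [sum_wedgeCoeff_mul k L fun K => wedgeCoeff k K J]
    refine if_ctx_congr Iff.rfl (fun hk => ?_) fun _ => rfl
    rw [wedgeCoeff, Finset.insert_erase hk, Finset.filter_erase,
      Finset.erase_eq_of_notMem (s := L.filter (· < k)) (by simp)]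
    by_cases hL : J = L
    · rw [if_pos ⟨Finset.notMem_erase _ _, hL.symm⟩, if_pos hL, ← mul_pow]
      simp
    · rw [if_neg fun h => hL h.2.symm, if_neg hL, mul_zero]
  rw [Finset.sum_congr rfl fun k _ => h k, Finset.sum_ite_mem, Finset.univ_inter]
  split_ifs <;> simp

/-- The complex Laplacian acts componentwise, as `-∑_k δ_k ∂/∂z̄_k + q`. -/
theorem boxTest_apply {n q : ℕ} (u : TestForm n q) (L : MultiIndex n q) :
    boxTest n q u L = numTest n (u L) + (q : ℂ) • u L := by
  have hnum : ∀ q (u : TestForm n q) (L : MultiIndex n q), numTest n (u L) =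
      -∑ k : Fin n, ∑ j : Fin n, ∑ J : MultiIndex n q,
        (if j = k ∧ J.1 = L.1 then (1 : ℂ) else 0) • deltaTest k (dzbarTest j (u J)) := by
    intro q u L
    simp only [numTest, LinearMap.neg_apply, LinearMap.sum_apply, LinearMap.comp_apply]
    congr 1
    refine Finset.sum_congr rfl fun k _ => ?_
    rw [Finset.sum_eq_single k, Finset.sum_eq_single L]
    · simp
    · intro J _ hJ
      rw [if_neg (fun h => hJ (Subtype.ext h.2)), zero_smul]
    · simp
    · intro j _ hj
      refine Finset.sum_eq_zero fun J _ => ?_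
      rw [if_neg (fun h => hj h.1), zero_smul]
    · simp
  rcases q with _ | q
  · change dbarStar n 0 (dbar n 0 u) L = _
    rw [dbarStar_dbar, hnum, Nat.cast_zero, zero_smul, add_zero]
    congr 1
    refine Finset.sum_congr rfl fun k _ => Finset.sum_congr rfl fun j _ =>
      Finset.sum_congr rfl fun J _ => ?_
    -- In degree `0` the missing summand `∂̄∂̄*` costs nothing: its coefficient would need a set `K`
    -- with `card K + 1 = 0`.
    have h0 : ∑ K, wedgeCoeff j K L.1 * wedgeCoeff k K J.1 = 0 := ?_
    · rw [← wedgeCoeff_anticomm j k L.1 J.1, h0, zero_add]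
    refine Finset.sum_eq_zero fun K _ => ?_
    by_contra h
    have := card_of_wedgeCoeff_ne_zero (left_ne_zero_of_mul h)
    rw [L.2] at this
    omega
  · change dbar n q (dbarStar n q u) L + dbarStar n (q + 1) (dbar n (q + 1) u) L = _
    -- These are the terms produced by commuting `∂/∂z̄_j` past `δ_k`; only `j = k` survives, and
    -- the coefficients add up to the degree.
    have hq : ((q + 1 : ℕ) : ℂ) • u L = ∑ k : Fin n, ∑ j : Fin n, ∑ J : MultiIndex n (q + 1),
        (∑ K, wedgeCoeff j K L.1 * wedgeCoeff k K J.1) • if j = k then u J else 0 := by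
      have h1 : ∀ k : Fin n, ∑ j : Fin n, ∑ J : MultiIndex n (q + 1),
          (∑ K, wedgeCoeff j K L.1 * wedgeCoeff k K J.1) • (if j = k then u J else 0) =
          ∑ J : MultiIndex n (q + 1), (∑ K, wedgeCoeff k K L.1 * wedgeCoeff k K J.1) • u J := by
        intro k
        rw [Finset.sum_eq_single k]
        · simp
        · intro j _ hj
          simp [hj]
        · simp
      rw [Finset.sum_congr rfl fun k _ => h1 k, Finset.sum_comm]
      simp_rw [← Finset.sum_smul, sum_wedgeCoeff_diag]
      rw [Finset.sum_eq_single L]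
      · simp [L.2]
      · intro J _ hJ
        rw [if_neg (fun h => hJ (Subtype.ext h)), zero_smul]
      · simp
    rw [dbar_dbarStar, dbarStar_dbar, hnum, hq, ← sub_eq_zero]
    simp_rw [dzbarTest_deltaTest, smul_sub, Finset.sum_sub_distrib, ← wedgeCoeff_anticomm,
      add_smul, Finset.sum_add_distrib]
    abel

/-! ### The number operator on polynomials -/

section NumPoly

open MvPolynomial

variable {n : ℕ}

/-- The commutator of two derivations is a derivation, and this one vanishes on the variables. -/
theorem pderiv_comm {σ R : Type*} [CommRing R] (i j : σ) (P : MvPolynomial σ R) :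
    pderiv i (pderiv j P) = pderiv j (pderiv i P) := by
  classical
  have h : ⁅pderiv (R := R) i, pderiv (R := R) j⁆ = 0 := by
    refine MvPolynomial.derivation_ext fun k => ?_
    rw [Derivation.commutator_apply, pderiv_X, pderiv_X, Pi.single_apply, Pi.single_apply]
    split_ifs <;> simp
  have h2 := congrArg (fun D => D P) h
  simpa [Derivation.commutator_apply, sub_eq_zero] using h2

/-- The operator `-∑_k δ_k ∂/∂z̄_k` on polynomials in `z` and `z̄`. -/
def numPoly (n : ℕ) : RealPoly n →ₗ[ℂ] RealPoly n where
  toFun P := ∑ k : Fin n, (X (Sum.inr k) * pderiv (Sum.inr k) P -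
    pderiv (Sum.inl k) (pderiv (Sum.inr k) P))
  map_add' P Q := by
    rw [← Finset.sum_add_distrib]
    refine Finset.sum_congr rfl fun k _ => ?_
    simp only [map_add]
    ring
  map_smul' c P := by
    rw [RingHom.id_apply, Finset.smul_sum]
    refine Finset.sum_congr rfl fun k _ => ?_
    simp only [Derivation.map_smul, mul_smul_comm, smul_sub]

theorem numPoly_apply (P : RealPoly n) : numPoly n P =
    ∑ k : Fin n, (X (Sum.inr k) * pderiv (Sum.inr k) P -
      pderiv (Sum.inl k) (pderiv (Sum.inr k) P)) := rfl

theorem pderiv_inr_X_inr (j k : Fin n) :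
    pderiv (Sum.inr j) (X (Sum.inr k) : RealPoly n) = if k = j then 1 else 0 := by
  rw [pderiv_X]
  by_cases h : k = j <;> simp [h]

theorem pderiv_inl_X_inl (j k : Fin n) :
    pderiv (Sum.inl j) (X (Sum.inl k) : RealPoly n) = if k = j then 1 else 0 := by
  rw [pderiv_X]
  by_cases h : k = j <;> simp [h]

theorem pderiv_inl_X_inr (j k : Fin n) :
    pderiv (Sum.inl j) (X (Sum.inr k) : RealPoly n) = 0 := by
  rw [pderiv_X]
  simp

theorem pderiv_inr_X_inl (j k : Fin n) :
    pderiv (Sum.inr j) (X (Sum.inl k) : RealPoly n) = 0 := by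
  rw [pderiv_X]
  simp

/-- With `N = numPoly n`, the four lemmas from here say `[N, z̄_j] = z̄_j - ∂/∂z_j`, `[N, z_j] =
-∂/∂z̄_j`, `[N, ∂/∂z_j] = 0` and `[N, ∂/∂z̄_j] = -∂/∂z̄_j`. Hence `z̄_j - ∂/∂z_j` raises eigenvalues
by one and `z_j - ∂/∂z̄_j` commutes with `N`. -/
theorem numPoly_X_inr_mul (j : Fin n) (P : RealPoly n) :
    numPoly n (X (Sum.inr j) * P) =
      X (Sum.inr j) * numPoly n P + X (Sum.inr j) * P - pderiv (Sum.inl j) P := by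
  have h : ∀ k : Fin n, X (Sum.inr k) * pderiv (Sum.inr k) (X (Sum.inr j) * P) -
      pderiv (Sum.inl k) (pderiv (Sum.inr k) (X (Sum.inr j) * P)) =
      X (Sum.inr j) * (X (Sum.inr k) * pderiv (Sum.inr k) P -
        pderiv (Sum.inl k) (pderiv (Sum.inr k) P)) +
      if j = k then X (Sum.inr j) * P - pderiv (Sum.inl j) P else 0 := by
    intro k
    rw [pderiv_mul, pderiv_inr_X_inr]
    by_cases h : j = k
    · subst h
      simp only [if_true, one_mul, map_add, pderiv_mul, pderiv_inl_X_inr]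
      ring
    · simp only [h, if_false, zero_mul, zero_add, pderiv_mul, pderiv_inl_X_inr]
      ring
  rw [numPoly_apply, Finset.sum_congr rfl fun k _ => h k, Finset.sum_add_distrib,
    ← Finset.mul_sum, Finset.sum_ite_eq, if_pos (Finset.mem_univ _), numPoly_apply]
  ring

theorem numPoly_X_inl_mul (j : Fin n) (P : RealPoly n) :
    numPoly n (X (Sum.inl j) * P) = X (Sum.inl j) * numPoly n P - pderiv (Sum.inr j) P := by
  have h : ∀ k : Fin n, X (Sum.inr k) * pderiv (Sum.inr k) (X (Sum.inl j) * P) -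
      pderiv (Sum.inl k) (pderiv (Sum.inr k) (X (Sum.inl j) * P)) =
      X (Sum.inl j) * (X (Sum.inr k) * pderiv (Sum.inr k) P -
        pderiv (Sum.inl k) (pderiv (Sum.inr k) P)) -
      if j = k then pderiv (Sum.inr j) P else 0 := by
    intro k
    rw [pderiv_mul, pderiv_inr_X_inl, zero_mul, zero_add, pderiv_mul, pderiv_inl_X_inl]
    by_cases h : j = k
    · subst h
      simp only [if_true, one_mul]
      ring
    · simp only [h, if_false, zero_mul, zero_add]
      ring
  rw [numPoly_apply, Finset.sum_congr rfl fun k _ => h k, Finset.sum_sub_distrib,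
    ← Finset.mul_sum, Finset.sum_ite_eq, if_pos (Finset.mem_univ _), numPoly_apply]

theorem numPoly_pderiv_inl (j : Fin n) (P : RealPoly n) :
    numPoly n (pderiv (Sum.inl j) P) = pderiv (Sum.inl j) (numPoly n P) := by
  rw [numPoly_apply, numPoly_apply, map_sum]
  refine Finset.sum_congr rfl fun k _ => ?_
  rw [map_sub, pderiv_mul, pderiv_inl_X_inr, pderiv_comm (Sum.inr k) (Sum.inl j),
    pderiv_comm (Sum.inl k) (Sum.inl j)]
  ring

theorem numPoly_pderiv_inr (j : Fin n) (P : RealPoly n) :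
    numPoly n (pderiv (Sum.inr j) P) =
      pderiv (Sum.inr j) (numPoly n P) - pderiv (Sum.inr j) P := by
  have h : ∀ k : Fin n, pderiv (Sum.inr j) (X (Sum.inr k) * pderiv (Sum.inr k) P -
      pderiv (Sum.inl k) (pderiv (Sum.inr k) P)) =
      (X (Sum.inr k) * pderiv (Sum.inr k) (pderiv (Sum.inr j) P) -
      pderiv (Sum.inl k) (pderiv (Sum.inr k) (pderiv (Sum.inr j) P))) +
      if j = k then pderiv (Sum.inr j) P else 0 := by
    intro k
    rw [map_sub, pderiv_mul, pderiv_inr_X_inr, pderiv_comm (Sum.inr j) (Sum.inr k),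
      pderiv_comm (Sum.inr j) (Sum.inl k), pderiv_comm (Sum.inr j) (Sum.inr k)]
    by_cases h : j = k
    · subst h
      simp only [if_true, one_mul]
      ring
    · simp only [h, Ne.symm h, if_false, zero_mul, zero_add]
      ring
  rw [numPoly_apply P, map_sum, Finset.sum_congr rfl fun k _ => h k, Finset.sum_add_distrib,
    Finset.sum_ite_eq, if_pos (Finset.mem_univ _), numPoly_apply, add_sub_cancel_right]

/-- The eigenvectors of `numPoly n` with eigenvalue `m` that are annihilated by all products of
`m + 1` derivatives `∂/∂z̄_k`. -/
def landau (n : ℕ) : ℕ → Submodule ℂ (RealPoly n)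
  | 0 => ⨅ k : Fin n, LinearMap.ker (pderiv (R := ℂ) (Sum.inr k : Fin n ⊕ Fin n)).toLinearMap
  | m + 1 => LinearMap.ker (numPoly n - ((m + 1 : ℕ) : ℂ) • LinearMap.id) ⊓
      ⨅ k : Fin n, (landau n m).comap (pderiv (R := ℂ) (Sum.inr k : Fin n ⊕ Fin n)).toLinearMap

theorem mem_landau_zero {P : RealPoly n} :
    P ∈ landau n 0 ↔ ∀ k : Fin n, pderiv (Sum.inr k) P = 0 := by
  simp [landau, Submodule.mem_iInf]

theorem mem_landau_succ {m : ℕ} {P : RealPoly n} : P ∈ landau n (m + 1) ↔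
    numPoly n P = ((m + 1 : ℕ) : ℂ) • P ∧ ∀ k : Fin n, pderiv (Sum.inr k) P ∈ landau n m := by
  simp [landau, Submodule.mem_iInf, sub_eq_zero]

theorem numPoly_of_mem_landau {m : ℕ} {P : RealPoly n} (hP : P ∈ landau n m) :
    numPoly n P = (m : ℂ) • P := by
  cases m with
  | zero =>
    rw [mem_landau_zero] at hP
    simp [numPoly_apply, hP]
  | succ m => exact (mem_landau_succ.1 hP).1

theorem pderiv_inl_mem_landau (j : Fin n) {m : ℕ} {P : RealPoly n} (hP : P ∈ landau n m) :
    pderiv (Sum.inl j) P ∈ landau n m := by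
  induction m generalizing P with
  | zero =>
    rw [mem_landau_zero] at hP ⊢
    intro k
    rw [pderiv_comm, hP, map_zero]
  | succ m ih =>
    rw [mem_landau_succ] at hP ⊢
    refine ⟨by rw [numPoly_pderiv_inl, hP.1, Derivation.map_smul], fun k => ?_⟩
    rw [pderiv_comm]
    exact ih (hP.2 k)

/-- The operator `z_j - ∂/∂z̄_j` commutes with `numPoly` and with every `∂/∂z̄_k`, so it preserves
each level. -/
theorem lower_mem_landau (j : Fin n) {m : ℕ} {P : RealPoly n} (hP : P ∈ landau n m) :
    X (Sum.inl j) * P - pderiv (Sum.inr j) P ∈ landau n m := by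
  induction m generalizing P with
  | zero =>
    rw [mem_landau_zero] at hP ⊢
    intro k
    rw [hP j, sub_zero, pderiv_mul, hP k, pderiv_inr_X_inl]
    ring
  | succ m ih =>
    rw [mem_landau_succ] at hP ⊢
    refine ⟨?_, fun k => ?_⟩
    · rw [map_sub, numPoly_X_inl_mul, numPoly_pderiv_inr, hP.1, Derivation.map_smul,
        mul_smul_comm, smul_sub]
      ring
    · rw [map_sub, pderiv_mul, pderiv_inr_X_inl, zero_mul, zero_add, pderiv_comm]
      exact ih (hP.2 k)

theorem raise_mem_landau (j : Fin n) {m : ℕ} {P : RealPoly n} (hP : P ∈ landau n m) :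
    X (Sum.inr j) * P - pderiv (Sum.inl j) P ∈ landau n (m + 1) := by
  have hnum : numPoly n (X (Sum.inr j) * P - pderiv (Sum.inl j) P) =
      ((m + 1 : ℕ) : ℂ) • (X (Sum.inr j) * P - pderiv (Sum.inl j) P) := by
    rw [map_sub, numPoly_X_inr_mul, numPoly_pderiv_inl, numPoly_of_mem_landau hP,
      Derivation.map_smul, mul_smul_comm, Nat.cast_succ, add_smul, one_smul, smul_sub]
    ring
  have hcomm : ∀ k : Fin n, pderiv (Sum.inr k) (X (Sum.inr j) * P - pderiv (Sum.inl j) P) =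
      (X (Sum.inr j) * pderiv (Sum.inr k) P - pderiv (Sum.inl j) (pderiv (Sum.inr k) P)) +
        if j = k then P else 0 := by
    intro k
    rw [map_sub, pderiv_mul, pderiv_inr_X_inr, pderiv_comm (Sum.inr k)]
    split_ifs <;> ring
  refine mem_landau_succ.2 ⟨hnum, fun k => ?_⟩
  rw [hcomm]
  refine Submodule.add_mem _ ?_ ?_
  rotate_left
  · split_ifs
    exacts [hP, Submodule.zero_mem _]
  -- The remaining claim, that raising `∂P/∂z̄_k` lands in level `m`, is proved by induction on `m`
  -- for all `P`: a further derivative `∂/∂z̄_l` reproduces the claim for `∂P/∂z̄_l`, plus a term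
  -- already in the right level.
  clear hcomm hnum
  induction m generalizing P with
  | zero =>
    rw [mem_landau_zero] at hP
    rw [hP k]
    simp
  | succ m ih =>
    have hk := (mem_landau_succ.1 hP).2
    have hnum' : numPoly n (pderiv (Sum.inr k) P) = (m : ℂ) • pderiv (Sum.inr k) P :=
      numPoly_of_mem_landau (hk k)
    refine mem_landau_succ.2 ⟨?_, fun l => ?_⟩
    · rw [map_sub, numPoly_X_inr_mul, numPoly_pderiv_inl, hnum', Derivation.map_smul,
        mul_smul_comm, Nat.cast_succ, add_smul, one_smul, smul_sub]
      ring
    · rw [map_sub, pderiv_mul, pderiv_inr_X_inr, pderiv_comm (Sum.inr l) (Sum.inl j),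
        pderiv_comm (Sum.inr l) (Sum.inr k), add_sub_assoc]
      refine Submodule.add_mem _ ?_ (ih (hk l))
      split_ifs
      · rw [one_mul]
        exact hk k
      · rw [zero_mul]
        exact Submodule.zero_mem _

theorem map_mem_iSup_landau (T : RealPoly n →ₗ[ℂ] RealPoly n)
    (hT : ∀ m, ∀ P ∈ landau n m, T P ∈ ⨆ m, landau n m) {P : RealPoly n}
    (hP : P ∈ ⨆ m, landau n m) : T P ∈ ⨆ m, landau n m := by
  have h : (⨆ m, landau n m) ≤ (⨆ m, landau n m).comap T := iSup_le fun m P hP => hT m P hP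
  exact h hP

/-- Each variable is a level-preserving or raising operator plus a derivative. The derivative
condition built into `landau` keeps `∂P/∂z̄_j` in a lower level, and makes it zero at level `0`
without any positivity argument. -/
theorem X_mul_mem_iSup_landau (i : Fin n ⊕ Fin n) {P : RealPoly n}
    (hP : P ∈ ⨆ m, landau n m) : X i * P ∈ ⨆ m, landau n m := by
  have hle : ∀ m, landau n m ≤ ⨆ m, landau n m := le_iSup (landau n)
  refine map_mem_iSup_landau (LinearMap.mulLeft ℂ (X i)) (fun m P hP => ?_) hP
  rw [LinearMap.mulLeft_apply]
  rcases i with j | j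
  · rw [← sub_add_cancel (X (Sum.inl j) * P) (pderiv (Sum.inr j) P)]
    refine Submodule.add_mem _ (hle m (lower_mem_landau j hP)) ?_
    cases m with
    | zero =>
      rw [mem_landau_zero.1 hP j]
      exact Submodule.zero_mem _
    | succ m => exact hle m ((mem_landau_succ.1 hP).2 j)
  · rw [← sub_add_cancel (X (Sum.inr j) * P) (pderiv (Sum.inl j) P)]
    exact Submodule.add_mem _ (hle (m + 1) (raise_mem_landau j hP))
      (hle m (pderiv_inl_mem_landau j hP))

theorem iSup_landau : ⨆ m, landau n m = ⊤ := by
  refine eq_top_iff.2 fun P _ => ?_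
  induction P using MvPolynomial.induction_on with
  | C c =>
    refine le_iSup (landau n) 0 (mem_landau_zero.2 fun k => ?_)
    rw [pderiv_C]
  | add P Q hP hQ => exact Submodule.add_mem _ (hP trivial) (hQ trivial)
  | mul_X P i hP =>
    rw [mul_comm]
    exact X_mul_mem_iSup_landau i (hP trivial)

theorem delta_evalPoly (k : Fin n) (P : RealPoly n) :
    delta k (evalPoly P) = evalPoly (pderiv (Sum.inl k) P - X (Sum.inr k) * P) := by
  ext z
  rw [delta_apply, dz_evalPoly]
  simp [evalPoly]

theorem evalPoly_numPoly (P : RealPoly n) (z : Fin n → ℂ) :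
    evalPoly (numPoly n P) z = -∑ k : Fin n, delta k (dzbar k (evalPoly P)) z := by
  simp_rw [dzbar_evalPoly, delta_evalPoly]
  simp [evalPoly, numPoly_apply]

end NumPoly

/-! ### Functions of exponential growth -/

section Growth

variable {n : ℕ}

/-- The function `exp (c (|z_1| + ⋯ + |z_n|))`. -/
def expSum (c : ℝ) (z : Fin n → ℂ) : ℝ := Real.exp (c * ∑ j, ‖z j‖)

theorem expSum_add (c d : ℝ) (z : Fin n → ℂ) : expSum (c + d) z = expSum c z * expSum d z := by
  rw [expSum, expSum, expSum, ← Real.exp_add, add_mul]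

theorem expSum_pos (c : ℝ) (z : Fin n → ℂ) : 0 < expSum c z := Real.exp_pos _

theorem expSum_mono {c d : ℝ} (h : c ≤ d) (z : Fin n → ℂ) : expSum c z ≤ expSum d z := by
  unfold expSum
  gcongr

theorem integrable_exp_neg_half_norm_sq :
    Integrable fun w : ℂ => Real.exp (-(1 / 2) * ‖w‖ ^ 2) := by
  have h := (GaussianFourier.integrable_cexp_neg_mul_sq_norm_add (V := ℂ) (b := 1 / 2)
    (by norm_num) 0 0).norm
  refine h.congr (Filter.Eventually.of_forall fun w => ?_)
  simp only [Complex.norm_exp]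
  congr 1
  rw [zero_mul, add_zero, ← Complex.ofReal_pow, Complex.re_mul_ofReal]
  norm_num

theorem integrable_exp_sub_norm_sq (c : ℝ) :
    Integrable fun w : ℂ => Real.exp (c * ‖w‖ - ‖w‖ ^ 2) := by
  refine Integrable.mono' (integrable_exp_neg_half_norm_sq.const_mul (Real.exp (c ^ 2 / 2)))
    (by fun_prop) (Filter.Eventually.of_forall fun w => ?_)
  rw [Real.norm_of_nonneg (Real.exp_pos _).le, ← Real.exp_add]
  refine Real.exp_le_exp.2 ?_
  -- This is `c t ≤ c² / 2 + t² / 2` with `t = ‖w‖`.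
  nlinarith [sq_nonneg (c - ‖w‖)]

/-- The integrand against Lebesgue measure is a product of one-variable functions. Exponential
growth, rather than polynomial growth, is needed to dominate the series of `exp (i L z)` in the
density proof. -/
theorem integrable_expSum (c : ℝ) : Integrable (expSum c) (weightMeasure n) := by
  rw [weightMeasure, integrable_withDensity_iff
    continuous_exp_neg_weight.measurable.ennreal_ofReal
    (Filter.Eventually.of_forall fun _ => ENNReal.ofReal_lt_top)]
  have h := Integrable.fintype_prod (ι := Fin n) (μ := fun _ => (volume : Measure ℂ))
    (f := fun _ (w : ℂ) => Real.exp (c * ‖w‖ - ‖w‖ ^ 2)) fun _ => integrable_exp_sub_norm_sq c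
  refine h.congr (Filter.Eventually.of_forall fun z => ?_)
  dsimp only
  rw [ENNReal.toReal_ofReal (Real.exp_pos _).le, expSum, ← Real.exp_add, ← Real.exp_sum, weight,
    Finset.sum_sub_distrib, Finset.mul_sum, sub_eq_add_neg]

theorem memLp_of_norm_le_expSum {f : (Fin n → ℂ) → ℂ} (hf : Continuous f) {C c : ℝ}
    (h : ∀ z, ‖f z‖ ≤ C * expSum c z) : MemLp f 2 (weightMeasure n) := by
  rw [memLp_two_iff_integrable_sq_norm hf.aestronglyMeasurable]
  refine Integrable.mono' ((integrable_expSum (c + c)).const_mul (C ^ 2))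
    (hf.norm.pow 2).aestronglyMeasurable (Filter.Eventually.of_forall fun z => ?_)
  rw [Real.norm_of_nonneg (by positivity), expSum_add, ← sq, ← mul_pow]
  exact pow_le_pow_left₀ (norm_nonneg _) (h z) 2

instance isFiniteMeasure_weightMeasure : IsFiniteMeasure (weightMeasure n) := by
  have h := integrable_expSum (n := n) 0
  have h1 : (expSum 0 : (Fin n → ℂ) → ℝ) = fun _ => 1 := by
    ext z
    simp [expSum]
  rw [h1, integrable_const_iff] at h
  exact h.resolve_left one_ne_zero

theorem norm_coord_le_expSum (j : Fin n) (z : Fin n → ℂ) : ‖z j‖ ≤ expSum 1 z := by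
  have h1 : ‖z j‖ ≤ ∑ j, ‖z j‖ :=
    Finset.single_le_sum (f := fun j => ‖z j‖) (fun _ _ => norm_nonneg _) (Finset.mem_univ j)
  rw [expSum, one_mul]
  linarith [Real.add_one_le_exp (∑ j, ‖z j‖)]

theorem exists_norm_evalPoly_le (P : RealPoly n) :
    ∃ C c : ℝ, 0 ≤ C ∧ 0 ≤ c ∧ ∀ z, ‖evalPoly P z‖ ≤ C * expSum c z := by
  induction P using MvPolynomial.induction_on with
  | C a =>
    refine ⟨‖a‖, 0, norm_nonneg _, le_rfl, fun z => ?_⟩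
    rw [evalPoly_C]
    simp [expSum]
  | add P Q hP hQ =>
    obtain ⟨C, c, hC, hc, hP⟩ := hP
    obtain ⟨D, d, hD, hd, hQ⟩ := hQ
    refine ⟨C + D, c + d, add_nonneg hC hD, add_nonneg hc hd, fun z => ?_⟩
    rw [evalPoly_add]
    have h1 := mul_le_mul_of_nonneg_left (expSum_mono (le_add_of_nonneg_right hd : c ≤ c + d) z) hC
    have h2 := mul_le_mul_of_nonneg_left (expSum_mono (le_add_of_nonneg_left hc : d ≤ c + d) z) hD
    calc ‖evalPoly P z + evalPoly Q z‖ ≤ ‖evalPoly P z‖ + ‖evalPoly Q z‖ := norm_add_le _ _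
      _ ≤ (C + D) * expSum (c + d) z := by linarith [hP z, hQ z]
  | mul_X P i hP =>
    obtain ⟨C, c, hC, hc, hP⟩ := hP
    refine ⟨C, c + 1, hC, by linarith, fun z => ?_⟩
    have h1 : ‖evalPoly (MvPolynomial.X i) z‖ ≤ expSum 1 z := by
      rcases i with j | j
      · rw [evalPoly_X_inl]
        exact norm_coord_le_expSum j z
      · rw [evalPoly_X_inr, RCLike.norm_conj]
        exact norm_coord_le_expSum j z
    rw [evalPoly_mul, norm_mul, expSum_add, ← mul_assoc]
    exact mul_le_mul (hP z) h1 (norm_nonneg _) (mul_nonneg hC (expSum_pos _ _).le)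

theorem memLp_evalPoly (P : RealPoly n) : MemLp (evalPoly P) 2 (weightMeasure n) := by
  obtain ⟨C, c, -, -, h⟩ := exists_norm_evalPoly_le P
  exact memLp_of_norm_le_expSum (contDiff_evalPoly P).continuous h

/-! ### Density of the polynomials -/

/-- A real function with vanishing Fourier transform is zero. -/
theorem ae_eq_zero_of_fourier_real {E : Type*} [NormedAddCommGroup E] [NormedSpace ℝ E]
    [CompleteSpace E] [MeasurableSpace E] [BorelSpace E] [SecondCountableTopology E]
    {μ : Measure E} {r : E → ℝ} (hr : Integrable r μ)
    (h : ∀ L : StrongDual ℝ E, ∫ x, (r x : ℂ) * Complex.exp (L x * Complex.I) ∂μ = 0) :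
    r =ᵐ[μ] 0 := by
  have hm := hr.aestronglyMeasurable.aemeasurable
  have fin1 := isFiniteMeasure_withDensity_ofReal hr.hasFiniteIntegral
  have fin2 := isFiniteMeasure_withDensity_ofReal hr.neg.hasFiniteIntegral
  have hexp : ∀ L : StrongDual ℝ E, ∀ x : E, ‖Complex.exp (L x * Complex.I)‖ ≤ 1 := fun L x =>
    (Complex.norm_exp_ofReal_mul_I _).le
  have hint : ∀ (L : StrongDual ℝ E) {s : E → ℝ}, Integrable s μ →
      Integrable (fun x => s x • Complex.exp (L x * Complex.I)) μ := by
    intro L s hs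
    have h0 : Integrable (fun x => (s x : ℂ)) μ := hs.ofReal
    have h1 := h0.mul_bdd (c := 1)
      (g := fun x => Complex.exp (L x * Complex.I))
      (Continuous.aestronglyMeasurable (by fun_prop)) (Filter.Eventually.of_forall (hexp L))
    simpa only [Complex.real_smul] using h1
  -- The positive and negative parts of `r` are densities of finite measures with the same
  -- characteristic function, hence equal measures.
  have heq : μ.withDensity (fun x => ENNReal.ofReal (r x)) =
      μ.withDensity (fun x => ENNReal.ofReal ((-r) x)) := by
    refine Measure.ext_of_charFunDual (funext fun L => ?_)
    rw [charFunDual_apply, charFunDual_apply,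
      integral_withDensity_eq_integral_toReal_smul₀ hm.ennreal_ofReal
        (Filter.Eventually.of_forall fun _ => ENNReal.ofReal_lt_top),
      integral_withDensity_eq_integral_toReal_smul₀ hm.neg.ennreal_ofReal
        (Filter.Eventually.of_forall fun _ => ENNReal.ofReal_lt_top), ← sub_eq_zero]
    simp_rw [ENNReal.toReal_ofReal']
    rw [← integral_sub (hint L hr.pos_part) (hint L hr.neg.pos_part), ← h L]
    refine integral_congr_ae (Filter.Eventually.of_forall fun x => ?_)
    dsimp only
    rw [← sub_smul, Complex.real_smul]
    congr 2
    rw [Pi.neg_apply]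
    rcases le_total (r x) 0 with h0 | h0
    · rw [max_eq_right h0, max_eq_left (by linarith)]
      ring
    · rw [max_eq_left h0, max_eq_right (by linarith)]
      ring
  rw [withDensity_eq_iff hm.ennreal_ofReal hm.neg.ennreal_ofReal
    (by
      have := fin1.measure_univ_lt_top
      rw [withDensity_apply _ MeasurableSet.univ, setLIntegral_univ] at this
      exact this.ne)] at heq
  filter_upwards [heq] with x hx
  have hx' := congrArg ENNReal.toReal hx
  rw [ENNReal.toReal_ofReal', ENNReal.toReal_ofReal', Pi.neg_apply] at hx'
  rw [Pi.zero_apply]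
  rcases le_total (r x) 0 with h0 | h0
  · rw [max_eq_right h0, max_eq_left (by linarith)] at hx'
    linarith
  · rw [max_eq_left h0, max_eq_right (by linarith)] at hx'
    exact hx'

/-- A complex function with vanishing Fourier transform is zero. -/
theorem ae_eq_zero_of_fourier {E : Type*} [NormedAddCommGroup E] [NormedSpace ℝ E]
    [CompleteSpace E] [MeasurableSpace E] [BorelSpace E] [SecondCountableTopology E]
    {μ : Measure E} {g : E → ℂ} (hg : Integrable g μ)
    (h : ∀ L : StrongDual ℝ E, ∫ x, g x * Complex.exp (L x * Complex.I) ∂μ = 0) :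
    g =ᵐ[μ] 0 := by
  have hint : ∀ (L : StrongDual ℝ E) {s : E → ℂ}, Integrable s μ →
      Integrable (fun x => s x * Complex.exp (L x * Complex.I)) μ := by
    intro L s hs
    refine hs.mul_bdd (c := 1) (Continuous.aestronglyMeasurable (by fun_prop))
      (Filter.Eventually.of_forall fun x => (Complex.norm_exp_ofReal_mul_I _).le)
  have hconj : Integrable (fun x => starRingEnd ℂ (g x)) μ :=
    (LinearIsometryEquiv.integrable_comp_iff Complex.conjLIE).2 hg
  -- Conjugating the hypothesis at `-L` gives the vanishing for the conjugate of `g`, hence for the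
  -- real and imaginary parts.
  have h' : ∀ L : StrongDual ℝ E,
      ∫ x, starRingEnd ℂ (g x) * Complex.exp (L x * Complex.I) ∂μ = 0 := by
    intro L
    rw [← map_zero (starRingEnd ℂ), ← h (-L), ← integral_conj]
    refine integral_congr_ae (Filter.Eventually.of_forall fun x => ?_)
    simp [← Complex.exp_conj]
  have hre : (fun x => (g x).re) =ᵐ[μ] 0 := by
    refine ae_eq_zero_of_fourier_real hg.re fun L => ?_
    have h1 : ∀ x, ((g x).re : ℂ) * Complex.exp (L x * Complex.I) =
        (1 / 2 : ℂ) * (g x * Complex.exp (L x * Complex.I) +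
          starRingEnd ℂ (g x) * Complex.exp (L x * Complex.I)) := fun x => by
      rw [← add_mul, Complex.add_conj]
      push_cast
      ring
    simp_rw [h1]
    rw [integral_const_mul, integral_add (hint L hg) (hint L hconj), h, h', add_zero, mul_zero]
  have him : (fun x => (g x).im) =ᵐ[μ] 0 := by
    refine ae_eq_zero_of_fourier_real hg.im fun L => ?_
    have h1 : ∀ x, ((g x).im : ℂ) * Complex.exp (L x * Complex.I) =
        (1 / (2 * Complex.I) : ℂ) * (g x * Complex.exp (L x * Complex.I) -
          starRingEnd ℂ (g x) * Complex.exp (L x * Complex.I)) := fun x => by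
      rw [← sub_mul, Complex.sub_conj]
      push_cast
      field_simp
    simp_rw [h1]
    rw [integral_const_mul, integral_sub (hint L hg) (hint L hconj), h, h', sub_zero, mul_zero]
  filter_upwards [hre, him] with x h1 h2
  exact Complex.ext h1 h2

theorem exists_evalPoly_eq_dual (L : StrongDual ℝ (Fin n → ℂ)) :
    ∃ P : RealPoly n, ∀ z, evalPoly P z = (L z : ℂ) := by
  refine ⟨∑ j, (MvPolynomial.C ((L (Pi.single j 1) : ℂ) / 2) *
      (MvPolynomial.X (Sum.inl j) + MvPolynomial.X (Sum.inr j)) +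
    MvPolynomial.C ((L (Pi.single j Complex.I) : ℂ) / (2 * Complex.I)) *
      (MvPolynomial.X (Sum.inl j) - MvPolynomial.X (Sum.inr j))), fun z => ?_⟩
  have hz : z = ∑ j, ((z j).re • (Pi.single j 1 : Fin n → ℂ) +
      (z j).im • (Pi.single j Complex.I : Fin n → ℂ)) := by
    ext k
    simp [Finset.sum_apply, Pi.single_apply, Finset.sum_add_distrib]
  conv_rhs => rw [hz]
  simp only [evalPoly, map_sum, map_add, map_mul, map_sub, MvPolynomial.eval_C,
    MvPolynomial.eval_X, Sum.elim_inl, Sum.elim_inr, map_smul, smul_eq_mul, Complex.ofReal_sum,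
    Complex.ofReal_add, Complex.ofReal_mul, Complex.add_conj, Complex.sub_conj]
  refine Finset.sum_congr rfl fun j _ => ?_
  push_cast
  field_simp

theorem abs_dual_le (L : StrongDual ℝ (Fin n → ℂ)) (z : Fin n → ℂ) :
    |L z| ≤ ‖L‖ * ∑ j, ‖z j‖ := by
  rw [← Real.norm_eq_abs]
  refine (L.le_opNorm z).trans ?_
  gcongr
  refine (pi_norm_le_iff_of_nonneg (Finset.sum_nonneg fun _ _ => norm_nonneg _)).2 fun j => ?_
  exact Finset.single_le_sum (f := fun j => ‖z j‖) (fun _ _ => norm_nonneg _) (Finset.mem_univ j)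

/-- A real functional `L` is a polynomial in `z` and `z̄`, so `g` annihilates every term of the
series of `exp (i L)`. Dominated convergence, with majorant `|g| exp |L|` (a product of two `L²`
functions), makes the Fourier transform of `g` vanish. -/
theorem ae_eq_zero_of_integral_mul_evalPoly {g : (Fin n → ℂ) → ℂ}
    (hg : MemLp g 2 (weightMeasure n))
    (h : ∀ P : RealPoly n, ∫ z, g z * evalPoly P z ∂(weightMeasure n) = 0) :
    g =ᵐ[weightMeasure n] 0 := by
  refine ae_eq_zero_of_fourier (hg.integrable (by norm_num)) fun L => ?_
  obtain ⟨P, hP⟩ := exists_evalPoly_eq_dual L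
  have hterm : ∀ m : ℕ, ∫ z, g z * ((L z * Complex.I) ^ m / (m.factorial : ℂ))
      ∂(weightMeasure n) = 0 := by
    intro m
    rw [← h (MvPolynomial.C (Complex.I ^ m / (m.factorial : ℂ)) * P ^ m)]
    refine integral_congr_ae (Filter.Eventually.of_forall fun z => ?_)
    have h1 : evalPoly (P ^ m) z = evalPoly P z ^ m := by simp [evalPoly]
    rw [evalPoly_mul, evalPoly_C]
    dsimp only
    rw [h1, hP]
    ring
  have hmeas : ∀ m : ℕ, AEStronglyMeasurable
      (fun z => g z * ((L z * Complex.I) ^ m / (m.factorial : ℂ))) (weightMeasure n) := fun m =>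
    hg.1.mul (Continuous.aestronglyMeasurable (by fun_prop))
  have hbound : ∀ m : ℕ, ∀ z, ‖g z * ((L z * Complex.I) ^ m / (m.factorial : ℂ))‖ ≤
      ‖g z‖ * (|L z| ^ m / (m.factorial : ℝ)) := fun m z => by
    rw [norm_mul, norm_div, norm_pow, norm_mul, Complex.norm_I, mul_one,
      Complex.norm_real, Complex.norm_natCast, Real.norm_eq_abs]
  have hlim : ∀ z, HasSum (fun m : ℕ => g z * ((L z * Complex.I) ^ m / (m.factorial : ℂ)))
      (g z * Complex.exp (L z * Complex.I)) := fun z => by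
    refine HasSum.mul_left _ ?_
    rw [Complex.exp_eq_exp_ℂ]
    exact NormedSpace.expSeries_div_hasSum_exp _
  have hsum := hasSum_integral_of_dominated_convergence (μ := weightMeasure n) _ hmeas
    (fun m => Filter.Eventually.of_forall (hbound m))
    (Filter.Eventually.of_forall fun z => (Real.summable_pow_div_factorial _).mul_left _) ?_
    (Filter.Eventually.of_forall hlim)
  · simp_rw [hterm] at hsum
    exact hsum.unique hasSum_zero
  · have h1 : ∀ z, ∑' m : ℕ, ‖g z‖ * (|L z| ^ m / (m.factorial : ℝ)) =
        ‖g z‖ * Real.exp |L z| := fun z => by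
      rw [tsum_mul_left, Real.exp_eq_exp_ℝ, NormedSpace.exp_eq_tsum_div]
    simp_rw [h1]
    have h2 : MemLp (fun z : Fin n → ℂ => ((Real.exp |L z| : ℝ) : ℂ)) 2 (weightMeasure n) := by
      refine memLp_of_norm_le_expSum (C := 1) (c := ‖L‖) (by fun_prop) fun z => ?_
      rw [Complex.norm_real, Real.norm_of_nonneg (Real.exp_pos _).le, one_mul, expSum]
      exact Real.exp_le_exp.2 (abs_dual_le L z)
    refine (hg.norm.integrable_mul h2.norm).congr (Filter.Eventually.of_forall fun z => ?_)
    simp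

end Growth

/-! ### Approximation of polynomials by test functions -/

section Cutoff

open Filter Topology

variable {n : ℕ}

/-- Dominated convergence in `L²`: the squared differences are bounded by `(2 G)²`. -/
theorem tendsto_toLp_of_dominated {α : Type*} [MeasurableSpace α] {μ : Measure α}
    {f : ℕ → α → ℂ} {g : α → ℂ} {G : α → ℝ} (hf : ∀ m, MemLp (f m) 2 μ) (hg : MemLp g 2 μ)
    (hG : MemLp G 2 μ) (hbound : ∀ m x, ‖f m x‖ ≤ G x)
    (hlim : ∀ x, Tendsto (fun m => f m x) atTop (𝓝 (g x))) :
    Tendsto (fun m => (hf m).toLp (f m)) atTop (𝓝 (hg.toLp g)) := by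
  rw [Lp.tendsto_Lp_iff_tendsto_eLpNorm'']
  have hgG : ∀ x, ‖g x‖ ≤ G x := fun x => le_of_tendsto' (hlim x).norm fun m => hbound m x
  have hG2 : ∀ x, (0 : ℝ) ≤ G x := fun x => (norm_nonneg _).trans (hgG x)
  have hlint : Tendsto (fun m => ∫⁻ x, ENNReal.ofReal (‖f m x - g x‖ ^ 2) ∂μ) atTop (𝓝 0) := by
    have h0 : ∫⁻ x, (0 : ENNReal) ∂μ = 0 := by simp
    rw [← h0]
    refine tendsto_lintegral_of_dominated_convergence' (fun x => ENNReal.ofReal ((2 * G x) ^ 2))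
      (fun m => (((hf m).1.sub hg.1).norm.aemeasurable.pow_const 2).ennreal_ofReal)
      (fun m => Eventually.of_forall fun x => ENNReal.ofReal_le_ofReal ?_) ?_
      (Eventually.of_forall fun x => ?_)
    · refine pow_le_pow_left₀ (norm_nonneg _) ?_ 2
      linarith [norm_sub_le (f m x) (g x), hbound m x, hgG x]
    · have h1 : Integrable (fun x => (2 * G x) ^ 2) μ := by
        have := ((memLp_two_iff_integrable_sq_norm hG.1).1 hG).const_mul 4
        refine this.congr (Eventually.of_forall fun x => ?_)
        dsimp only
        rw [Real.norm_eq_abs, sq_abs]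
        ring
      rw [← ofReal_integral_eq_lintegral_ofReal h1 (Eventually.of_forall fun x => by positivity)]
      exact ENNReal.ofReal_ne_top
    · have h1 : Tendsto (fun m => ‖f m x - g x‖ ^ 2) atTop (𝓝 0) := by
        have := (((hlim x).sub_const (g x)).norm).pow 2
        simpa using this
      simpa using ENNReal.tendsto_ofReal h1
  have hrpow := (ENNReal.continuous_rpow_const (y := 1 / 2)).tendsto 0 |>.comp hlint
  rw [ENNReal.zero_rpow_of_pos (by norm_num)] at hrpow
  refine hrpow.congr fun m => ?_
  rw [eLpNorm_eq_lintegral_rpow_enorm_toReal two_ne_zero ENNReal.ofNat_ne_top]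
  simp only [Function.comp_apply, ENNReal.toReal_ofNat]
  congr 1
  refine lintegral_congr fun x => ?_
  rw [ENNReal.ofReal_pow (norm_nonneg _), ofReal_norm, Pi.sub_apply]
  norm_cast

theorem dz_comp_smul (k : Fin n) (c : ℝ) (f : (Fin n → ℂ) → ℂ) (z : Fin n → ℂ) :
    dz k (fun w => f (c • w)) z = c * dz k f (c • z) := by
  simp only [dz, fderiv_comp_smul, smul_apply, Complex.real_smul]
  ring

theorem dzbar_comp_smul (k : Fin n) (c : ℝ) (f : (Fin n → ℂ) → ℂ) (z : Fin n → ℂ) :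
    dzbar k (fun w => f (c • w)) z = c * dzbar k f (c • z) := by
  simp only [dzbar, fderiv_comp_smul, smul_apply, Complex.real_smul]
  ring

theorem dz_const_mul (k : Fin n) (c : ℂ) {f : (Fin n → ℂ) → ℂ} {z : Fin n → ℂ}
    (hf : DifferentiableAt ℝ f z) : dz k (fun w => c * f w) z = c * dz k f z := by
  rw [dz_mul k (differentiableAt_const c) hf, dz_const, zero_mul, zero_add]

/-- A uniformly smooth family of cutoff functions exhausting `ℂⁿ`. -/
theorem exists_cutoff (n : ℕ) : ∃ (χ : ℕ → (Fin n → ℂ) → ℂ) (B : ℝ), 0 ≤ B ∧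
    (∀ m, ContDiff ℝ ∞ (χ m)) ∧ (∀ m, HasCompactSupport (χ m)) ∧
    (∀ m z, ‖χ m z‖ ≤ B) ∧ (∀ m k z, ‖dz k (χ m) z‖ ≤ B) ∧ (∀ m k z, ‖dzbar k (χ m) z‖ ≤ B) ∧
    (∀ m k z, ‖dz k (dzbar k (χ m)) z‖ ≤ B) ∧ ∀ z, ∀ᶠ m in atTop, χ m =ᶠ[𝓝 z] fun _ => 1 := by
  let b : ContDiffBump (0 : Fin n → ℂ) := ⟨1, 2, one_pos, one_lt_two⟩
  let f : (Fin n → ℂ) → ℂ := fun z => (b z : ℂ)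
  have hf : ContDiff ℝ ∞ f := Complex.ofRealCLM.contDiff.comp b.contDiff
  have hfc : HasCompactSupport f := b.hasCompactSupport.comp_left Complex.ofReal_zero
  obtain ⟨B₀, hB₀⟩ := hf.continuous.bounded_above_of_compact_support hfc
  choose B₁ hB₁ using fun k : Fin n =>
    (contDiff_dz k hf).continuous.bounded_above_of_compact_support (hasCompactSupport_dz k hfc)
  choose B₂ hB₂ using fun k : Fin n =>
    (contDiff_dzbar k hf).continuous.bounded_above_of_compact_support
      (hasCompactSupport_dzbar k hfc)
  choose B₃ hB₃ using fun k : Fin n =>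
    (contDiff_dz k (contDiff_dzbar k hf)).continuous.bounded_above_of_compact_support
      (hasCompactSupport_dz k (hasCompactSupport_dzbar k hfc))
  let B : ℝ := |B₀| + ∑ k, (|B₁ k| + |B₂ k| + |B₃ k|)
  have hk : ∀ k, |B₁ k| + |B₂ k| + |B₃ k| ≤ ∑ k, (|B₁ k| + |B₂ k| + |B₃ k|) := fun k =>
    Finset.single_le_sum (f := fun k => |B₁ k| + |B₂ k| + |B₃ k|) (fun _ _ => by positivity)
      (Finset.mem_univ k)
  -- The cutoffs are dilations `b (z / (m + 1))` of one bump function. Each derivative gains a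
  -- factor `c m ≤ 1`, so the bounds are uniform in `m`.
  let c : ℕ → ℝ := fun m => 1 / ((m : ℝ) + 1)
  have hc0 : ∀ m, 0 < c m := fun m => Nat.one_div_pos_of_nat
  have hc1 : ∀ m, c m ≤ 1 := fun m => by
    rw [div_le_one (by positivity)]
    linarith [(Nat.cast_nonneg m : (0 : ℝ) ≤ m)]
  have hcB : ∀ m {x : ℂ} {D : ℝ}, ‖x‖ ≤ D → ‖(c m : ℂ) * x‖ ≤ D := fun m x D h => by
    rw [norm_mul, Complex.norm_real, Real.norm_of_nonneg (hc0 m).le]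
    exact (mul_le_of_le_one_left (norm_nonneg _) (hc1 m)).trans h
  refine ⟨fun m z => f (c m • z), B, by positivity, fun m => hf.comp (by fun_prop),
    fun m => hfc.comp_smul (hc0 m).ne', fun m z => ?_, fun m k z => ?_, fun m k z => ?_,
    fun m k z => ?_, fun z => ?_⟩
  · have : 0 ≤ ∑ k, (|B₁ k| + |B₂ k| + |B₃ k|) := by positivity
    exact (hB₀ _).trans ((le_abs_self _).trans (le_add_of_nonneg_right this))
  · rw [dz_comp_smul]
    refine (hcB m (hB₁ k _)).trans ?_
    linarith [hk k, le_abs_self (B₁ k), abs_nonneg B₀, abs_nonneg (B₂ k), abs_nonneg (B₃ k)]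
  · rw [dzbar_comp_smul]
    refine (hcB m (hB₂ k _)).trans ?_
    linarith [hk k, le_abs_self (B₂ k), abs_nonneg B₀, abs_nonneg (B₁ k), abs_nonneg (B₃ k)]
  · have h1 : dzbar k (fun z => f (c m • z)) = fun z => (c m : ℂ) * dzbar k f (c m • z) :=
      funext fun w => dzbar_comp_smul k (c m) f w
    have hd : Differentiable ℝ fun z => dzbar k f (c m • z) :=
      ((contDiff_dzbar k hf).comp (contDiff_const_smul (c m))).differentiable (by simp)
    rw [h1, dz_const_mul k _ (hd z), dz_comp_smul]
    refine (hcB m (hcB m (hB₃ k _))).trans ?_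
    linarith [hk k, le_abs_self (B₃ k), abs_nonneg B₀, abs_nonneg (B₁ k), abs_nonneg (B₂ k)]
  · have h1 : Tendsto (fun m => c m * ‖z‖) atTop (𝓝 0) := by
      have h2 : Tendsto c atTop (𝓝 0) := tendsto_one_div_add_atTop_nhds_zero_nat
      simpa only [zero_mul] using h2.mul_const ‖z‖
    filter_upwards [h1.eventually_lt_const one_pos] with m hm
    have hopen : IsOpen {w : Fin n → ℂ | ‖c m • w‖ < 1} :=
      isOpen_lt (by fun_prop) continuous_const
    have hz : z ∈ {w : Fin n → ℂ | ‖c m • w‖ < 1} := by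
      change ‖c m • z‖ < 1
      rw [norm_smul, Real.norm_of_nonneg (hc0 m).le]
      exact hm
    filter_upwards [hopen.mem_nhds hz] with w hw
    have : b (c m • w) = 1 := b.one_of_mem_closedBall (by
      rw [mem_closedBall_zero_iff]
      exact le_of_lt hw)
    simp [f, this]

theorem numTest_apply (f : TestFun n) (z : Fin n → ℂ) :
    numTest n f z = -∑ k : Fin n, delta k (dzbar k f) z := by
  have h : ∀ s : Finset (Fin n), (∑ k ∈ s, deltaTest k (dzbarTest k f)) z =
      ∑ k ∈ s, delta k (dzbar k f) z := by
    intro s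
    induction s using Finset.induction_on with
    | empty => rfl
    | insert a s ha ih =>
      rw [Finset.sum_insert ha, Finset.sum_insert ha, ← ih]
      rfl
  rw [← h, numTest, LinearMap.neg_apply, LinearMap.sum_apply]
  rfl

/-- The inclusion of the polynomials in `z` and `z̄` in `L²(ℂⁿ, e^{-φ})`. -/
def polyToL2 (n : ℕ) : RealPoly n →ₗ[ℂ] Lp ℂ 2 (weightMeasure n) where
  toFun P := (memLp_evalPoly P).toLp
  map_add' P Q := by
    rw [← MemLp.toLp_add]
    congr 1
    exact evalPoly_add P Q
  map_smul' c P := by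
    rw [RingHom.id_apply, ← MemLp.toLp_const_smul]
    congr 1
    ext z
    simp [evalPoly]

/-- The unbounded factor `z̄_k` of `δ_k` is absorbed in the terms acting on `f`; the cutoff `χ`
enters only through plain derivatives, which are uniformly bounded. -/
theorem delta_dzbar_mul (k : Fin n) {χ f : (Fin n → ℂ) → ℂ} (hχ : ContDiff ℝ ∞ χ)
    (hf : ContDiff ℝ ∞ f) (z : Fin n → ℂ) :
    delta k (dzbar k fun w => χ w * f w) z = dz k (dzbar k χ) z * f z +
      dzbar k χ z * delta k f z + dz k χ z * dzbar k f z + χ z * delta k (dzbar k f) z := by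
  have hd : ∀ {g : (Fin n → ℂ) → ℂ}, ContDiff ℝ ∞ g → ∀ z, DifferentiableAt ℝ g z :=
    fun hg z => hg.differentiable (by simp) z
  have h1 : (dzbar k fun w => χ w * f w) = fun w => dzbar k χ w * f w + χ w * dzbar k f w :=
    funext fun w => dzbar_mul k (hd hχ w) (hd hf w)
  have hd1 := hd (contDiff_dzbar k hχ)
  have hd2 := hd (contDiff_dzbar k hf)
  rw [h1, delta_apply, dz_add k ((hd1 z).fun_mul (hd hf z)) ((hd hχ z).fun_mul (hd2 z)),
    dz_mul k (hd1 z) (hd hf z), dz_mul k (hd hχ z) (hd2 z), delta_apply, delta_apply]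
  ring

theorem dzbar_congr {k : Fin n} {f g : (Fin n → ℂ) → ℂ} {z : Fin n → ℂ} (h : f =ᶠ[𝓝 z] g) :
    dzbar k f =ᶠ[𝓝 z] dzbar k g := by
  filter_upwards [h.eventuallyEq_nhds] with w hw
  rw [dzbar, dzbar, hw.fderiv_eq]

theorem delta_congr {k : Fin n} {f g : (Fin n → ℂ) → ℂ} {z : Fin n → ℂ} (h : f =ᶠ[𝓝 z] g) :
    delta k f z = delta k g z := by
  rw [delta_apply, delta_apply, dz, dz, h.fderiv_eq, h.eq_of_nhds]

/-- Polynomials belong to the domain of the closure of `-∑_k δ_k ∂/∂z̄_k`. -/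
theorem exists_testFun_tendsto_poly (P : RealPoly n) : ∃ f : ℕ → TestFun n,
    Tendsto (fun m => testToL2 n (f m)) atTop (𝓝 (polyToL2 n P)) ∧
    Tendsto (fun m => testToL2 n (numTest n (f m))) atTop (𝓝 (polyToL2 n (numPoly n P))) := by
  obtain ⟨χ, B, hB, hχ, hχc, h0, h1, h2, h3, hlim⟩ := exists_cutoff n
  have hP := contDiff_evalPoly P
  obtain ⟨f, hf⟩ : ∃ f : ℕ → TestFun n, ∀ m, (f m : (Fin n → ℂ) → ℂ) =
      fun z => χ m z * evalPoly P z :=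
    ⟨fun m => ⟨fun z => χ m z * evalPoly P z, (hχ m).mul hP, (hχc m).mul_right,
      fun _ _ => trivial⟩, fun m => rfl⟩
  have hfapp : ∀ m z, f m z = χ m z * evalPoly P z := fun m z => congrFun (hf m) z
  have heq : ∀ z, ∀ᶠ m in atTop, (f m : (Fin n → ℂ) → ℂ) =ᶠ[𝓝 z] evalPoly P := fun z => by
    filter_upwards [hlim z] with m hm
    filter_upwards [hm] with w hw
    rw [hfapp, hw, one_mul]
  refine ⟨f, ?_, ?_⟩
  · refine tendsto_toLp_of_dominated (f := fun m => f m) (g := evalPoly P)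
      (fun m => (f m).memLp) (memLp_evalPoly P) (G := fun z => B * ‖evalPoly P z‖)
      ((memLp_evalPoly P).norm.const_mul B) (fun m z => ?_)
      fun z => ?_
    · rw [hfapp, norm_mul]
      exact mul_le_mul_of_nonneg_right (h0 m z) (norm_nonneg _)
    · refine tendsto_const_nhds.congr' ?_
      filter_upwards [heq z] with m hm
      exact hm.eq_of_nhds.symm
  -- The majorant collects the four Leibniz terms; each is the norm of a polynomial and so lies in
  -- `L²`.
  · let G : (Fin n → ℂ) → ℝ := fun z => B * ∑ k : Fin n, (‖evalPoly P z‖ +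
      ‖delta k (evalPoly P) z‖ + ‖dzbar k (evalPoly P) z‖ +
        ‖delta k (dzbar k (evalPoly P)) z‖)
    have hterm : ∀ k : Fin n, MemLp (fun z => ‖evalPoly P z‖ + ‖delta k (evalPoly P) z‖ +
        ‖dzbar k (evalPoly P) z‖ + ‖delta k (dzbar k (evalPoly P)) z‖) 2 (weightMeasure n) := by
      intro k
      rw [dzbar_evalPoly, delta_evalPoly, delta_evalPoly]
      exact (((memLp_evalPoly _).norm.add (memLp_evalPoly _).norm).add
        (memLp_evalPoly _).norm).add (memLp_evalPoly _).norm
    have hG : MemLp G 2 (weightMeasure n) :=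
      (memLp_finsetSum Finset.univ fun k _ => hterm k).const_mul B
    refine tendsto_toLp_of_dominated (f := fun m => numTest n (f m))
      (g := evalPoly (numPoly n P)) (fun m => (numTest n (f m)).memLp)
      (memLp_evalPoly (numPoly n P)) hG (fun m z => ?_) fun z => ?_
    · rw [numTest_apply, norm_neg]
      refine (norm_sum_le _ _).trans ?_
      change _ ≤ B * _
      rw [Finset.mul_sum]
      refine Finset.sum_le_sum fun k _ => ?_
      rw [hf, delta_dzbar_mul k (hχ m) hP, mul_add, mul_add, mul_add]
      refine (norm_add_le _ _).trans (add_le_add ((norm_add_le _ _).trans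
        (add_le_add ((norm_add_le _ _).trans (add_le_add ?_ ?_)) ?_)) ?_) <;> rw [norm_mul]
      · exact mul_le_mul_of_nonneg_right (h3 m k z) (norm_nonneg _)
      · exact mul_le_mul_of_nonneg_right (h2 m k z) (norm_nonneg _)
      · exact mul_le_mul_of_nonneg_right (h1 m k z) (norm_nonneg _)
      · exact mul_le_mul_of_nonneg_right (h0 m z) (norm_nonneg _)
    -- Near a fixed point the cutoff is eventually identically `1`, so the derivatives agree as well
    -- and the sequence is eventually constant.
    · refine tendsto_const_nhds.congr' ?_
      filter_upwards [heq z] with m hm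
      rw [numTest_apply, evalPoly_numPoly]
      congr 1
      exact Finset.sum_congr rfl fun k _ => (delta_congr (dzbar_congr hm)).symm

end Cutoff

/-! ### Symmetry -/

section Symmetry

variable {n : ℕ}

theorem integral_dzbar_mul (k : Fin n) {f g : (Fin n → ℂ) → ℂ} (hf : ContDiff ℝ ∞ f)
    (hg : ContDiff ℝ ∞ g) (hfc : HasCompactSupport f) :
    ∫ z, dzbar k f z * g z = -∫ z, f z * dzbar k g z := by
  have hdf : Continuous (fderiv ℝ f) := hf.continuous_fderiv (by simp)
  have hdg : Continuous (fderiv ℝ g) := hg.continuous_fderiv (by simp)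
  have hfd : ∀ v, HasCompactSupport fun z => fderiv ℝ f z v := fun v =>
    hfc.fderiv_apply (𝕜 := ℝ) v
  have i1 : ∀ v, Integrable fun z => fderiv ℝ f z v * g z := fun v =>
    Continuous.integrable_of_hasCompactSupport (by fun_prop) (hfd v).mul_right
  have i2 : ∀ v, Integrable fun z => f z * fderiv ℝ g z v := fun v =>
    Continuous.integrable_of_hasCompactSupport (by fun_prop) hfc.mul_right
  have i3 : Integrable fun z => f z * g z :=
    Continuous.integrable_of_hasCompactSupport (by fun_prop) hfc.mul_right
  have key : ∀ v, ∫ z, f z * fderiv ℝ g z v = -∫ z, fderiv ℝ f z v * g z := fun v =>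
    integral_mul_fderiv_eq_neg_fderiv_mul_of_integrable (i1 v) (i2 v) i3
      (fun x _ => hf.differentiable (by simp) x) fun x _ => hg.differentiable (by simp) x
  have e1 : ∀ z, dzbar k f z * g z = (1 / 2 : ℂ) * (fderiv ℝ f z (Pi.single k 1) * g z +
      Complex.I * (fderiv ℝ f z (Pi.single k Complex.I) * g z)) := fun z => by
    rw [dzbar]
    ring
  have e2 : ∀ z, f z * dzbar k g z = (1 / 2 : ℂ) * (f z * fderiv ℝ g z (Pi.single k 1) +
      Complex.I * (f z * fderiv ℝ g z (Pi.single k Complex.I))) := fun z => by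
    rw [dzbar]
    ring
  simp_rw [e1, e2]
  rw [integral_const_mul, integral_const_mul, integral_add (i1 _) ((i1 _).const_mul _),
    integral_add (i2 _) ((i2 _).const_mul _), integral_const_mul, integral_const_mul, key, key]
  ring

theorem dzbar_conj (k : Fin n) {f : (Fin n → ℂ) → ℂ} {z : Fin n → ℂ}
    (hf : DifferentiableAt ℝ f z) :
    dzbar k (fun w => starRingEnd ℂ (f w)) z = starRingEnd ℂ (dz k f z) := by
  have h : fderiv ℝ (fun w => starRingEnd ℂ (f w)) z =
      (Complex.conjCLE : ℂ →L[ℝ] ℂ).comp (fderiv ℝ f z) :=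
    ((Complex.conjCLE : ℂ →L[ℝ] ℂ).hasFDerivAt.comp z hf.hasFDerivAt).fderiv
  rw [dzbar, dz, h]
  simp [(map_ofNat (starRingEnd ℂ) 2)]

theorem dzbar_weight (k : Fin n) (z : Fin n → ℂ) :
    dzbar k (fun w => (weight w : ℂ)) z = z k := by
  rw [funext weight_eq_evalPoly, dzbar_evalPoly]
  simp [evalPoly, MvPolynomial.pderiv_X, Pi.single_apply]

theorem contDiff_cexp_neg_weight :
    ContDiff ℝ ∞ fun z : Fin n → ℂ => Complex.exp (-(weight z : ℂ)) :=
  (Complex.ofRealCLM.contDiff.comp contDiff_weight).neg.cexp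

theorem dzbar_cexp_neg_weight (k : Fin n) (z : Fin n → ℂ) :
    dzbar k (fun w => Complex.exp (-(weight w : ℂ))) z =
      -(z k * Complex.exp (-(weight z : ℂ))) := by
  have hw : DifferentiableAt ℝ (fun w : Fin n → ℂ => (weight w : ℂ)) z :=
    (Complex.ofRealCLM.contDiff.comp contDiff_weight).differentiable (n := ∞) (by simp) z
  have h : fderiv ℝ (fun w => Complex.exp (-(weight w : ℂ))) z =
      Complex.exp (-(weight z : ℂ)) • -fderiv ℝ (fun w : Fin n → ℂ => (weight w : ℂ)) z :=
    hw.hasFDerivAt.neg.cexp.fderiv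
  rw [dzbar, h, ← dzbar_weight k z, dzbar]
  simp only [smul_apply, neg_apply, smul_eq_mul]
  ring

theorem inner_testToL2 (f g : TestFun n) : inner ℂ (testToL2 n f) (testToL2 n g) =
    ∫ z, starRingEnd ℂ (f z) * Complex.exp (-(weight z : ℂ)) * g z := by
  have h : inner ℂ (testToL2 n f) (testToL2 n g) =
      ∫ z, g z * starRingEnd ℂ (f z) ∂(weightMeasure n) := by
    rw [L2.inner_def]
    refine integral_congr_ae ?_
    filter_upwards [f.memLp.coeFn_toLp, g.memLp.coeFn_toLp] with z hf hg
    change inner ℂ (f.memLp.toLp f z) (g.memLp.toLp g z) = _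
    rw [hf, hg, RCLike.inner_apply]
  rw [h, weightMeasure, integral_withDensity_eq_integral_toReal_smul
    continuous_exp_neg_weight.measurable.ennreal_ofReal
    (Filter.Eventually.of_forall fun _ => ENNReal.ofReal_lt_top)]
  refine integral_congr_ae (Filter.Eventually.of_forall fun z => ?_)
  dsimp only
  rw [ENNReal.toReal_ofReal (Real.exp_pos _).le, Complex.real_smul, Complex.ofReal_exp,
    Complex.ofReal_neg]
  ring

/-- On test functions, `-∂/∂z̄_k` is the formal adjoint of `δ_k`. -/
theorem inner_deltaTest (k : Fin n) (f g : TestFun n) :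
    inner ℂ (testToL2 n (deltaTest k f)) (testToL2 n g) =
      -inner ℂ (testToL2 n f) (testToL2 n (dzbarTest k g)) := by
  rw [inner_testToL2, inner_testToL2]
  have hf := f.contDiff
  have hconj : ContDiff ℝ ∞ fun z => starRingEnd ℂ (f z) :=
    Complex.conjCLE.contDiff.comp hf
  have hsmooth : ContDiff ℝ ∞ fun z => starRingEnd ℂ (f z) * Complex.exp (-(weight z : ℂ)) :=
    hconj.mul contDiff_cexp_neg_weight
  have hsupp : HasCompactSupport fun z => starRingEnd ℂ (f z) * Complex.exp (-(weight z : ℂ)) :=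
    (f.hasCompactSupport.comp_left (map_zero (starRingEnd ℂ))).mul_right
  refine Eq.trans ?_ (integral_dzbar_mul k hsmooth g.contDiff hsupp)
  refine integral_congr_ae (Filter.Eventually.of_forall fun z => ?_)
  dsimp only
  congr 1
  rw [dzbar_mul k (hconj.differentiable (by simp) z)
    (contDiff_cexp_neg_weight.differentiable (by simp) z), dzbar_conj k (f.differentiableAt z),
    dzbar_cexp_neg_weight]
  change starRingEnd ℂ (delta k f z) * _ = _
  rw [delta_apply, map_sub, map_mul, Complex.conj_conj]
  ring

/-- Both sides equal the Hermitian form `∑ ⟨∂f/∂z̄_k, ∂g/∂z̄_k⟩`. -/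
theorem inner_numTest (f g : TestFun n) :
    inner ℂ (testToL2 n (numTest n f)) (testToL2 n g) =
      inner ℂ (testToL2 n f) (testToL2 n (numTest n g)) := by
  have h : ∀ f g : TestFun n, inner ℂ (testToL2 n (numTest n f)) (testToL2 n g) =
      ∑ k : Fin n, inner ℂ (testToL2 n (dzbarTest k f)) (testToL2 n (dzbarTest k g)) := by
    intro f g
    simp only [numTest, LinearMap.neg_apply, LinearMap.sum_apply, LinearMap.comp_apply, map_neg,
      map_sum, inner_neg_left, sum_inner, inner_deltaTest, Finset.sum_neg_distrib, neg_neg]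
  rw [h, ← inner_conj_symm (testToL2 n f), h, map_sum]
  simp only [inner_conj_symm]

end Symmetry

/-! ### The spectrum of the `∂̄`-Neumann Laplacian -/

section Box

open Filter Topology

variable {n q : ℕ}

theorem mem_graph_boxMin_iff {p : L2Form n q × L2Form n q} :
    p ∈ (boxMin n q).graph ↔ ∃ u, p = (formToL2 n q u, formToL2 n q (boxTest n q u)) := by
  have h : ∀ u (hu : formToL2 n q u ∈ (boxMin n q).domain),
      boxMin n q ⟨formToL2 n q u, hu⟩ = formToL2 n q (boxTest n q u) := by
    intro u hu
    change formToL2 n q (boxTest n q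
      ((LinearEquiv.ofInjective (formToL2 n q) (formToL2_injective n q)).symm
        ⟨formToL2 n q u, hu⟩)) = _
    congr 2
    exact (LinearEquiv.ofInjective (formToL2 n q) (formToL2_injective n q)).symm_apply_apply u
  rw [LinearPMap.mem_graph_iff]
  constructor
  · rintro ⟨⟨_, u, rfl⟩, h1, h2⟩
    exact ⟨u, Prod.ext h1.symm (h2.symm.trans (h u _))⟩
  · rintro ⟨u, rfl⟩
    exact ⟨⟨formToL2 n q u, u, rfl⟩, rfl, h u _⟩

/-- Symmetry is read off componentwise from `N + q` with `q` real, without adjointness of `dbar` and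
`dbarStar` on forms. -/
theorem isSymmetricOperator_boxMin : IsSymmetricOperator (boxMin n q) := by
  intro x hx y hy
  obtain ⟨u, rfl⟩ := mem_graph_boxMin_iff.1 hx
  obtain ⟨v, rfl⟩ := mem_graph_boxMin_iff.1 hy
  simp only [PiLp.inner_apply]
  refine Finset.sum_congr rfl fun J _ => ?_
  change inner ℂ (testToL2 n (boxTest n q u J)) (testToL2 n (v J)) =
    inner ℂ (testToL2 n (u J)) (testToL2 n (boxTest n q v J))
  simp only [boxTest_apply, map_add, map_smul, inner_add_left, inner_add_right, inner_smul_left,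
    inner_smul_right, inner_numTest, Complex.conj_natCast]

/-- The form `P dz̄_J`. -/
def polyForm (J : MultiIndex n q) : RealPoly n →ₗ[ℂ] L2Form n q :=
  (WithLp.linearEquiv 2 ℂ (MultiIndex n q → Lp ℂ 2 (weightMeasure n))).symm.toLinearMap ∘ₗ
    LinearMap.single ℂ (fun _ : MultiIndex n q => Lp ℂ 2 (weightMeasure n)) J ∘ₗ polyToL2 n

/-- Stated for the closure of the graph because closability is not yet known: this lemma also gives
density of the domain, from which closability follows. -/
theorem polyForm_mem_closure_graph (J : MultiIndex n q) (P : RealPoly n) :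
    (polyForm J P, polyForm J (numPoly n P + (q : ℂ) • P)) ∈
      (boxMin n q).graph.topologicalClosure := by
  obtain ⟨f, h1, h2⟩ := exists_testFun_tendsto_poly P
  have hc : Continuous fun x : Lp ℂ 2 (weightMeasure n) =>
      (WithLp.toLp 2 (Pi.single J x) : L2Form n q) := by
    have hs : Continuous fun x : Lp ℂ 2 (weightMeasure n) =>
        (Pi.single J x : MultiIndex n q → Lp ℂ 2 (weightMeasure n)) := by
      refine continuous_pi fun K => ?_
      by_cases h : K = J
      · subst h
        simp only [Pi.single_eq_same]
        exact continuous_id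
      · simp only [Pi.single_eq_of_ne h]
        exact continuous_const
    exact (PiLp.continuous_toLp 2 _).comp hs
  have h3 := (hc.tendsto _).comp h1
  have h4 := (hc.tendsto _).comp (h2.add (h1.const_smul (q : ℂ)))
  rw [map_add (polyForm J), map_smul (polyForm J)]
  have h5 : Tendsto (fun m => (WithLp.toLp 2 (Pi.single J
      (testToL2 n (numTest n (f m)) + (q : ℂ) • testToL2 n (f m))) : L2Form n q)) atTop
      (𝓝 (polyForm J (numPoly n P) + (q : ℂ) • polyForm J P)) := by
    rw [← map_smul, ← map_add, polyForm, LinearMap.comp_apply, LinearMap.comp_apply, map_add,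
      map_smul]
    exact h4
  have h6 : Tendsto (fun m => (WithLp.toLp 2 (Pi.single J (testToL2 n (f m))) : L2Form n q)) atTop
      (𝓝 (polyForm J P)) := h3
  change _ ∈ closure ((boxMin n q).graph : Set (L2Form n q × L2Form n q))
  refine mem_closure_of_tendsto (h6.prodMk_nhds h5)
    (Eventually.of_forall fun m => mem_graph_boxMin_iff.2 ⟨Pi.single J (f m), ?_⟩)
  have hform : ∀ u : TestForm n q,
      formToL2 n q u = WithLp.toLp 2 fun K => testToL2 n (u K) := fun u => rfl
  rw [hform, hform]
  refine Prod.ext ?_ ?_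
  · refine congrArg (WithLp.toLp 2) (funext fun K => ?_)
    by_cases h : K = J
    · subst h
      simp
    · simp [h]
  · refine congrArg (WithLp.toLp 2) (funext fun K => ?_)
    rw [boxTest_apply, map_add, map_smul]
    by_cases h : K = J
    · subst h
      simp
    · simp [h]

theorem inner_polyForm (J : MultiIndex n q) (P : RealPoly n) (x : L2Form n q) :
    inner ℂ (polyForm J P) x = inner ℂ (polyToL2 n P) (x J) := by
  rw [PiLp.inner_apply, Finset.sum_eq_single J]
  · change inner ℂ ((Pi.single J (polyToL2 n P) : MultiIndex n q → _) J) (x J) = _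
    rw [Pi.single_eq_same]
  · intro K _ hK
    change inner ℂ ((Pi.single J (polyToL2 n P) : MultiIndex n q → _) K) (x K) = _
    rw [Pi.single_eq_of_ne hK, inner_zero_left]
  · simp

theorem eq_zero_of_inner_polyToL2 {g : Lp ℂ 2 (weightMeasure n)}
    (h : ∀ P, inner ℂ (polyToL2 n P) g = 0) : g = 0 := by
  have hconj : MemLp (fun z => starRingEnd ℂ (g z)) 2 (weightMeasure n) := (Lp.memLp g).star
  have h1 : (fun z => starRingEnd ℂ (g z)) =ᵐ[weightMeasure n] 0 := by
    -- The inner product conjugates the polynomial; conjugating the whole integral moves the bar to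
    -- `g`.
    refine ae_eq_zero_of_integral_mul_evalPoly hconj fun P => ?_
    rw [← map_zero (starRingEnd ℂ), ← h P, L2.inner_def, ← integral_conj]
    refine integral_congr_ae ?_
    filter_upwards [(memLp_evalPoly P).coeFn_toLp] with z hz
    change _ = starRingEnd ℂ (inner ℂ ((memLp_evalPoly P).toLp _ z) (g z))
    rw [hz, RCLike.inner_apply, map_mul, Complex.conj_conj]
  rw [Lp.eq_zero_iff_ae_eq_zero]
  filter_upwards [h1] with z hz
  simpa using hz

/-- The forms with polynomial coefficients are dense. -/
theorem topologicalClosure_eq_top_of_polyForm_mem {D : Submodule ℂ (L2Form n q)}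
    (h : ∀ J P, polyForm J P ∈ D.topologicalClosure) : D.topologicalClosure = ⊤ := by
  rw [Submodule.topologicalClosure_eq_top_iff, Submodule.eq_bot_iff]
  intro x hx
  rw [← Submodule.orthogonal_closure] at hx
  ext1 J
  refine eq_zero_of_inner_polyToL2 fun P => ?_
  rw [← inner_polyForm]
  exact (Submodule.mem_orthogonal _ x).1 hx _ (h J P)

theorem dense_domain_boxMin : Dense ((boxMin n q).domain : Set (L2Form n q)) := by
  rw [Submodule.dense_iff_topologicalClosure_eq_top]
  refine topologicalClosure_eq_top_of_polyForm_mem fun J P => ?_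
  exact map_mem_closure (f := Prod.fst) (t := ((boxMin n q).domain : Set (L2Form n q)))
    continuous_fst (polyForm_mem_closure_graph J P) fun p hp =>
      LinearPMap.mem_domain_of_mem_graph (y := p.2) hp

theorem isClosable_boxMin : (boxMin n q).IsClosable :=
  isSymmetricOperator_boxMin.isClosable dense_domain_boxMin

theorem polyForm_mem_eigenspace_box (J : MultiIndex n q) {P : RealPoly n} {m : ℕ}
    (hP : numPoly n P = (m : ℂ) • P) :
    polyForm J P ∈ eigenspace (box n q) ((q + m : ℕ) : ℂ) := by
  rw [mem_eigenspace_iff, box, ← isClosable_boxMin.graph_closure_eq_closure_graph]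
  have h := polyForm_mem_closure_graph J P
  rw [hP, ← add_smul, map_smul, add_comm, ← Nat.cast_add] at h
  exact h

theorem iSup_eigenspace_box : (⨆ k : ℕ,
    eigenspace (box n q) (((q + k : ℕ) : ℝ) : ℂ)).topologicalClosure = ⊤ := by
  refine topologicalClosure_eq_top_of_polyForm_mem fun J P =>
    Submodule.le_topologicalClosure _ ?_
  have h : (⨆ m, landau n m) ≤ (⨆ k : ℕ,
      eigenspace (box n q) (((q + k : ℕ) : ℝ) : ℂ)).comap (polyForm J) := by
    refine iSup_le fun m P hP => Submodule.mem_iSup_of_mem m ?_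
    rw [Complex.ofReal_natCast]
    exact polyForm_mem_eigenspace_box J (numPoly_of_mem_landau hP)
  rw [iSup_landau] at h
  exact h Submodule.mem_top

/-- The polynomial `z̄_i^m p(z_j)`. -/
def monomialPoly (i j : Fin n) (m : ℕ) : Polynomial ℂ →ₗ[ℂ] RealPoly n :=
  LinearMap.mulLeft ℂ (MvPolynomial.X (Sum.inr i) ^ m) ∘ₗ
    (Polynomial.aeval (MvPolynomial.X (Sum.inl j) : RealPoly n)).toLinearMap

theorem monomialPoly_apply (i j : Fin n) (m : ℕ) (p : Polynomial ℂ) :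
    monomialPoly i j m p = MvPolynomial.X (Sum.inr i) ^ m *
      Polynomial.aeval (MvPolynomial.X (Sum.inl j) : RealPoly n) p := rfl

/-- Multiplication by `z̄_i` raises the eigenvalue by one up to the term `∂/∂z_i`, which vanishes
because `p` involves only `z_j` with `j ≠ i`. The second conjunct carries this through the
induction. -/
theorem numPoly_monomialPoly {i j : Fin n} (hij : i ≠ j) (m : ℕ) (p : Polynomial ℂ) :
    numPoly n (monomialPoly i j m p) = (m : ℂ) • monomialPoly i j m p ∧
      MvPolynomial.pderiv (Sum.inl i) (monomialPoly i j m p) = 0 := by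
  have hne : ∀ l : Fin n ⊕ Fin n, l ≠ Sum.inl j →
      MvPolynomial.pderiv l (Polynomial.aeval (MvPolynomial.X (Sum.inl j) : RealPoly n) p) = 0 := by
    intro l hl
    rw [Derivation.map_aeval, MvPolynomial.pderiv_X_of_ne hl.symm, smul_zero]
  induction m with
  | zero =>
    rw [monomialPoly_apply, pow_zero, one_mul]
    refine ⟨?_, hne _ (by simpa using hij)⟩
    rw [numPoly_apply, Nat.cast_zero, zero_smul]
    refine Finset.sum_eq_zero fun k _ => ?_
    rw [hne (Sum.inr k) (by simp), map_zero, mul_zero, sub_zero]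
  | succ m ih =>
    have h : monomialPoly i j (m + 1) p =
        MvPolynomial.X (Sum.inr i) * monomialPoly i j m p := by
      rw [monomialPoly_apply, monomialPoly_apply, pow_succ']
      ring
    rw [h]
    constructor
    · rw [numPoly_X_inr_mul, ih.1, ih.2, sub_zero, mul_smul_comm, Nat.cast_succ, add_smul,
        one_smul]
    · rw [MvPolynomial.pderiv_mul, pderiv_inl_X_inr, ih.2, zero_mul, mul_zero, add_zero]

theorem evalPoly_aeval_X_inl (j : Fin n) (p : Polynomial ℂ) (z : Fin n → ℂ) :
    evalPoly (Polynomial.aeval (MvPolynomial.X (Sum.inl j) : RealPoly n) p) z = p.eval (z j) := by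
  induction p using Polynomial.induction_on' with
  | add p r hp hr =>
    rw [map_add, evalPoly_add, Polynomial.eval_add]
    dsimp only
    rw [hp, hr]
  | monomial k a => simp [evalPoly, MvPolynomial.algebraMap_eq]

theorem eq_zero_of_polyToL2_monomialPoly_eq_zero {i j : Fin n} (hij : i ≠ j) (m : ℕ)
    {p : Polynomial ℂ} (h : polyToL2 n (monomialPoly i j m p) = 0) : p = 0 := by
  have h1 : evalPoly (monomialPoly i j m p) =ᵐ[weightMeasure n] fun _ => 0 :=
    (memLp_evalPoly _).coeFn_toLp.symm.trans ((Lp.eq_zero_iff_ae_eq_zero).1 h)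
  have h2 := (Continuous.ae_eq_iff_eq (weightMeasure n)
    (contDiff_evalPoly _).continuous continuous_const).1 h1
  refine Polynomial.funext fun t => ?_
  -- At the point with `z_j = t` and all other coordinates `1`, the factor `z̄_i^m` is `1` and the
  -- value is `p(t)`.
  have h3 := congrFun h2 (Function.update (fun _ => 1) j t)
  rw [monomialPoly_apply, evalPoly_mul] at h3
  dsimp only at h3
  rw [evalPoly_aeval_X_inl, Function.update_self] at h3
  have h4 : evalPoly (MvPolynomial.X (Sum.inr i) ^ m : RealPoly n)
      (Function.update (fun _ => 1) j t) = 1 := by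
    simp only [evalPoly, map_pow, MvPolynomial.eval_X, Sum.elim_inr, Function.update_of_ne hij,
      map_one, one_pow]
  rw [h4, one_mul] at h3
  rw [h3, Polynomial.eval_zero]

theorem not_finiteDimensional_eigenspace_box (hn : 1 < n) (hq : q ≤ n) (m : ℕ) :
    ¬ FiniteDimensional ℂ (eigenspace (box n q) ((q + m : ℕ) : ℂ)) := by
  intro hfin
  obtain ⟨J, -, hJ⟩ := Finset.exists_subset_card_eq
    (s := (Finset.univ : Finset (Fin n))) (n := q) (by simpa using hq)
  have hij : (⟨0, by omega⟩ : Fin n) ≠ ⟨1, hn⟩ := by simp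
  let T : Polynomial ℂ →ₗ[ℂ] eigenspace (box n q) ((q + m : ℕ) : ℂ) :=
    (polyForm (⟨J, hJ⟩ : MultiIndex n q) ∘ₗ
      monomialPoly (⟨0, by omega⟩ : Fin n) ⟨1, hn⟩ m).codRestrict _ fun p =>
        polyForm_mem_eigenspace_box _ (numPoly_monomialPoly hij m p).1
  have hT : Function.Injective T := by
    rw [← LinearMap.ker_eq_bot, LinearMap.ker_eq_bot']
    intro p hp
    have h1 : polyForm (⟨J, hJ⟩ : MultiIndex n q) (monomialPoly (⟨0, by omega⟩ : Fin n)
      ⟨1, hn⟩ m p) = 0 := congrArg Subtype.val hp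
    refine eq_zero_of_polyToL2_monomialPoly_eq_zero hij m ?_
    have h2 := congrArg (fun w : L2Form n q => w ⟨J, hJ⟩) h1
    simpa [polyForm] using h2
  exact Polynomial.not_finite (Module.Finite.of_injective T hT)

/-- The integers `≥ q` form a closed subset of `ℂ`, so a point outside has positive distance from
them. -/
theorem exists_pos_forall_le_norm_sub {μ : ℂ} (hμ : ∀ k : ℕ, q ≤ k → μ ≠ k) :
    ∃ d : ℝ, 0 < d ∧ ∀ k : ℕ, d ≤ ‖(((q + k : ℕ) : ℝ) : ℂ) - μ‖ := by
  have hemb : IsClosedEmbedding fun k : ℕ => ((k : ℝ) : ℂ) :=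
    Complex.isometry_ofReal.isClosedEmbedding.comp Nat.isClosedEmbedding_coe_real
  have hcl : IsClosed ((fun k : ℕ => ((k : ℝ) : ℂ)) '' {k | q ≤ k}) :=
    hemb.isClosedMap _ (isClosed_discrete _)
  have hmem : μ ∈ ((fun k : ℕ => ((k : ℝ) : ℂ)) '' {k | q ≤ k})ᶜ := by
    rintro ⟨k, hk, rfl⟩
    exact hμ k hk (by simp)
  obtain ⟨d, hd, hball⟩ := Metric.isOpen_iff.1 hcl.isOpen_compl μ hmem
  refine ⟨d, hd, fun k => ?_⟩
  by_contra! h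
  exact hball (mem_ball_iff_norm.2 h) ⟨q + k, Nat.le_add_right q k, rfl⟩

end Box

end FockDbar

end

/-! ### Self-adjointness, spectrum and multiplicities. -/

theorem theorem2 (n q : ℕ) (hn : 1 < n) (hq : q ≤ n) :
    IsSelfAdjoint (FockDbar.box n q) ∧
    FockDbar.spectrum (FockDbar.box n q) = {μ : ℂ | ∃ k : ℕ, q ≤ k ∧ μ = (k : ℂ)} ∧
    ∀ k : ℕ, q ≤ k → ¬ FiniteDimensional ℂ (FockDbar.eigenspace (FockDbar.box n q) (k : ℂ)) := by
  have hsym : FockDbar.IsSymmetricOperator (FockDbar.box n q) :=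
    FockDbar.isSymmetricOperator_boxMin.closure FockDbar.isClosable_boxMin
  have hcl : (FockDbar.box n q).IsClosed := FockDbar.isClosable_boxMin.closure_isClosed
  have hlam : Function.Injective fun k : ℕ => ((q + k : ℕ) : ℝ) := fun a b h => by
    have := Nat.cast_injective h
    omega
  have hinf : ∀ k : ℕ, q ≤ k →
      ¬ FiniteDimensional ℂ (FockDbar.eigenspace (FockDbar.box n q) (k : ℂ)) := fun k hk => by
    obtain ⟨m, rfl⟩ := Nat.exists_eq_add_of_le hk
    exact FockDbar.not_finiteDimensional_eigenspace_box hn hq m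
  refine ⟨hsym.isSelfAdjoint hcl hlam FockDbar.iSup_eigenspace_box fun k => Nat.cast_nonneg _,
    Set.Subset.antisymm (fun μ hμ => ?_) ?_, hinf⟩
  · by_contra hk
    obtain ⟨d, hd, hbound⟩ := FockDbar.exists_pos_forall_le_norm_sub (q := q) (μ := μ)
      fun k hqk h => hk ⟨k, hqk, h⟩
    exact hμ (hsym.mem_resolventSet hcl hlam FockDbar.iSup_eigenspace_box hd hbound)
  -- A point of the resolvent set has zero eigenspace, which contradicts infinite multiplicity.
  · rintro _ ⟨k, hk, rfl⟩ hres
    refine hinf k hk ?_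
    rw [FockDbar.eigenspace_eq_bot_of_mem_resolventSet hres]
    infer_instance
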